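/- Fix an integer $k\ge 1$, an integer $N\ge 0$, and reals $\lambda>0$ and $\epsilon,s\in(0,1)$. Let $(D_n)$ be a sequence of reals with $\log D_n/\log n\to 0$ and $D_n\ge 2\log_2 n$ for all large $n$; write $D=D_n$. *Correlated stochastic block model.* Let $\sigma\in[k]^n$ be a uniform labelling and $\pi$ an independent uniform permutation of $[n]$. Given these, let $G$ be a random graph on $[n]$ whose edges are independent, $\{i,j\}$ being an edge with probability $\frac{(1+(k-1)\epsilon)\lambda}{n}$ if $\sigma(i)=\sigma(j)$ and $\frac{(1-\epsilon)\lambda}{n}$ otherwise ($n$ is taken so large that these are at most $1$). With further independent Bernoulli($s$) variables $J_{i,j},K_{i,j}$ put $$A_{i,j}=G_{i,j}J_{i,j},\qquad B_{i,j}=G_{\pi^{-1}(i),\pi^{-1}(j)}K_{i,j}.$$ *Bad graphs.* Let $\tilde\lambda=\max(\lambda,1)$. For a subgraph $H=(V(H),E(H))$ of the complete graph $\mathcal K_n$ let $$\Phi(H)=\Big(\frac{2\tilde\lambda^2k^2n}{D^{50}}\Big)^{|V(H)|}\Big(\frac{1000\tilde\lambda^{20}k^{20}D^{50}}{n}\Big)^{|E(H)|}.$$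 Call $H$ *bad* if $\Phi(H)<(\log n)^{-1}$, and *self-bad* if it is bad and $\Phi(H)<\Phi(K)$ for every proper subgraph $K$ of $H$. Let $\mathcal E$ be the event that $G$ contains no bad subgraph with at most $D^3$ vertices and no cycle of length at most $N$. Let $\mathbb P(\cdot\mid\mathcal E)$ be the conditional law of $(A,B)$ given $\mathcal E$. *Modified model.* Let $B_1,\dots,B_M$ be all self-bad subgraphs of $\mathcal K_n$ with at most $D^3$ vertices and all cycles of $\mathcal K_n$ of length at most $N$. Given $\sigma,\pi,G$ as above, for every $i$ with $B_i\subset G$ choose, independently over $i$, a uniformly random edge of $B_i$ (no edge if $B_i$ has none), and let $G'$ be $G$ with all chosen edges removed. Put $A'_{i,j}=G'_{i,j}J'_{i,j}$ and $B'_{i,j}=G'_{\pi^{-1}(i),\pi^{-1}(j)}K'_{i,j}$ with independent Bernoulli($s$) variables $J'_{i,j},K'_{i,j}$, independent of $(\sigma,\pi,G,G')$. Let $\mathbb P'$ be the law of $(A',B')$. Then, as $n\to\infty$, $$\operatorname{TV}\big(\mathbb P',\,\mathbb P(\cdot\mid\mathcal E)\big)\longrightarrow 0 .$$ -/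

import Mathlib

open Filter Topology MeasureTheory ProbabilityTheory
open scoped ENNReal

namespace CorrelatedSBM

noncomputable section

/-! ### Finite random experiments -/

/-- The total variation distance `sup_S |μ(S) - ν(S)|`, the supremum being over measurable sets. -/
def tvDist {Ω : Type*} [MeasurableSpace Ω] (μ ν : Measure Ω) : ℝ :=
  ⨆ S : {S : Set Ω // MeasurableSet S}, |μ.real S.1 - ν.real S.1|

/-- The Bernoulli law with parameter `p`. Values of `p` outside `[0, 1]` are clamped to `[0, 1]`. -/
def bernoulliLaw (p : ℝ) : PMF Bool :=
  PMF.ofFintype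
    (fun b => if b then ENNReal.ofReal (min p 1) else 1 - ENNReal.ofReal (min p 1))
    (by simp)

/-- The law of a finite family of independent random variables, the `i`-th having law `p i`. -/
def indepLaw {ι : Type*} [Fintype ι] {α : ι → Type*} [∀ i, Fintype (α i)]
    (p : ∀ i, PMF (α i)) : PMF (∀ i, α i) := by
  classical
  exact PMF.ofFintype (fun x => ∏ i, p i (x i)) (by
    have h1 : ∀ i, ∑ a, p i a = 1 := fun i => by
      rw [← tsum_fintype (L := .unconditional _)]
      exact (p i).tsum_coe
    calc ∑ x : ∀ i, α i, ∏ i, p i (x i)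
        = ∏ i, ∑ a, p i a := (Fintype.prod_sum (fun i a => p i a)).symm
      _ = 1 := by simp [h1])

/-! ### The correlated stochastic block model -/

/-- The set of unordered pairs of distinct elements of the vertex set. -/
abbrev Pairs (n : ℕ) : Type := {e : Sym2 (Fin n) // ¬ e.IsDiag}

/-- The law of a random graph in which the pairs `e` are edges independently of each other, the
pair `e` with probability `p e`. -/
def indepEdgeGraph (n : ℕ) (p : Pairs n → ℝ) : PMF (SimpleGraph (Fin n)) :=
  (indepLaw fun e => bernoulliLaw (p e)).map
    fun x => SimpleGraph.fromEdgeSet {e | ∃ h : ¬ e.IsDiag, x ⟨e, h⟩ = true}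

/-- The conditional law of the block model given the labelling `σ`: the pair `{i, j}` is an edge
with probability `(1 + (k - 1) ε) lam / n` if `σ i = σ j` (that is, if the image of `{i, j}`
under `σ` lies on the diagonal) and with probability `(1 - ε) lam / n` otherwise.
For `n ≥ k * lam` these numbers do lie in `[0, 1]`. -/
def sbmGivenLabels (n k : ℕ) (lam ε : ℝ) (σ : Fin n → Fin k) : PMF (SimpleGraph (Fin n)) := by
  classical
  exact indepEdgeGraph n fun e =>
    if (e.1.map σ).IsDiag then (1 + ((k : ℝ) - 1) * ε) * lam / n else (1 - ε) * lam / n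

/-- A realization of the correlated model: labelling, vertex permutation, parent graph and the
two observed graphs. -/
structure Sample (n k : ℕ) where
  σ : Fin n → Fin k
  π : Equiv.Perm (Fin n)
  G : SimpleGraph (Fin n)
  A : SimpleGraph (Fin n)
  B : SimpleGraph (Fin n)

instance (n k : ℕ) : MeasurableSpace (Sample n k) := ⊤

/-- The relabelled graph, in which `i, j` are adjacent iff `π⁻¹ i, π⁻¹ j` are adjacent in `G`. -/
def relabel {n : ℕ} (π : Equiv.Perm (Fin n)) (G : SimpleGraph (Fin n)) : SimpleGraph (Fin n) :=
  G.comap π.symm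

/-- The joint law of `(σ, π, G, A, B)`: `σ` and `π` are uniform and independent, `G` is the block
model, `A_{ij} = G_{ij} J_{ij}` and `B_{ij} = G_{π⁻¹ i, π⁻¹ j} K_{ij}` with independent
Bernoulli(`s`) variables `J_{ij}`, `K_{ij}`, here seen as the edge indicators of graphs. -/
def jointLaw (n k : ℕ) [NeZero k] (lam ε s : ℝ) : PMF (Sample n k) :=
  (PMF.uniformOfFintype (Fin n → Fin k)).bind fun σ =>
  (PMF.uniformOfFintype (Equiv.Perm (Fin n))).bind fun π =>
  (sbmGivenLabels n k lam ε σ).bind fun G =>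
  (indepEdgeGraph n fun _ => s).bind fun J =>
  (indepEdgeGraph n fun _ => s).bind fun K =>
  PMF.pure ⟨σ, π, G, G ⊓ J, relabel π G ⊓ K⟩

/-! ### Bad graphs, self-bad graphs and short cycles -/

/-- The subgraphs of the complete graph on `n` vertices: a set of vertices together with a set of
edges between these vertices. -/
abbrev KSubgraph (n : ℕ) : Type := (⊤ : SimpleGraph (Fin n)).Subgraph

/-- `Φ(H) = (2 lam'² k² n / D⁵⁰)^|V(H)| (1000 lam'²⁰ k²⁰ D⁵⁰ / n)^|E(H)|`
with `lam' = max lam 1`. -/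
def Phi (n k : ℕ) (lam D : ℝ) (H : KSubgraph n) : ℝ :=
  (2 * (max lam 1) ^ 2 * (k : ℝ) ^ 2 * n / D ^ 50) ^ H.verts.ncard *
    (1000 * (max lam 1) ^ 20 * (k : ℝ) ^ 20 * D ^ 50 / n) ^ H.edgeSet.ncard

/-- `H` is bad if `Φ(H) < (log n)⁻¹`. -/
def IsBad (n k : ℕ) (lam D : ℝ) (H : KSubgraph n) : Prop :=
  Phi n k lam D H < (Real.log n)⁻¹

/-- `H` is self-bad if it is bad and `Φ(H) < Φ(K)` for all proper subgraphs `K` of `H`. -/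
def IsSelfBad (n k : ℕ) (lam D : ℝ) (H : KSubgraph n) : Prop :=
  IsBad n k lam D H ∧ ∀ K : KSubgraph n, K < H → Phi n k lam D H < Phi n k lam D K

/-- `H` is a cycle of length at most `N`. -/
def IsShortCycle (n N : ℕ) (H : KSubgraph n) : Prop :=
  ∃ (u : Fin n) (w : (⊤ : SimpleGraph (Fin n)).Walk u u),
    w.IsCycle ∧ w.length ≤ N ∧ w.toSubgraph = H

/-- The number of vertices of `H` is at most `D³`. -/
def IsSmall (n : ℕ) (D : ℝ) (H : KSubgraph n) : Prop := (H.verts.ncard : ℝ) ≤ D ^ 3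

/-- `H` is a subgraph of the graph `G`, whose vertex set consists of all `n` vertices. -/
def IsSubgraphOf {n : ℕ} (H : KSubgraph n) (G : SimpleGraph (Fin n)) : Prop := H.edgeSet ⊆ G.edgeSet

/-- The graph `G` has no bad subgraph with at most `D³` vertices and no cycle of length at
most `N`. -/
def IsGood (n k N : ℕ) (lam D : ℝ) (G : SimpleGraph (Fin n)) : Prop :=
  ∀ H : KSubgraph n, IsSubgraphOf H G →
    ¬ (IsBad n k lam D H ∧ IsSmall n D H) ∧ ¬ IsShortCycle n N H

/-- The law of `(A, B)` conditioned on the event that the parent graph `G` is good. -/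
def condPairLaw (n k N : ℕ) [NeZero k] (lam ε s D : ℝ) :
    Measure (SimpleGraph (Fin n) × SimpleGraph (Fin n)) :=
  ((jointLaw n k lam ε s).toMeasure[|{x | IsGood n k N lam D x.G}]).map fun x => (x.A, x.B)

/-! ### The modified model -/

/-- The collection of the self-bad graphs with at most `D³` vertices and the cycles of length at
most `N` in the complete graph. -/
abbrev Target (n k N : ℕ) (lam D : ℝ) : Type :=
  {H : KSubgraph n // (IsSelfBad n k lam D H ∧ IsSmall n D H) ∨ IsShortCycle n N H}

instance (n k N : ℕ) (lam D : ℝ) : Fintype (Target n k N lam D) := Fintype.ofFinite _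

/-- The law of the edge of `H` that is selected for removal from `G`: a uniform edge of `H` if
`H` is a subgraph of `G` (with at least one edge), and none otherwise. -/
def selectedEdge {n : ℕ} (G : SimpleGraph (Fin n)) (H : KSubgraph n) :
    PMF (Option (Sym2 (Fin n))) := by
  classical
  exact
    if h : IsSubgraphOf H G ∧ H.edgeSet.Nonempty then
      (PMF.uniformOfFinset H.edgeSet.toFinset (Set.toFinset_nonempty.2 h.2)).map some
    else PMF.pure none

/-- The conditional law of `G'` given `G`: independently for every target graph `H ⊆ G` one
uniform edge of `H` is selected, and all selected edges are removed from `G`. -/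
def removalLaw (n k N : ℕ) (lam D : ℝ) (G : SimpleGraph (Fin n)) :
    PMF (SimpleGraph (Fin n)) :=
  (indepLaw fun H : Target n k N lam D => selectedEdge G H.1).map
    fun c => G.deleteEdges {e | ∃ H, c H = some e}

/-- A realization of the modified model. -/
structure ModifiedSample (n k : ℕ) where
  σ : Fin n → Fin k
  π : Equiv.Perm (Fin n)
  G : SimpleGraph (Fin n)
  G' : SimpleGraph (Fin n)
  A' : SimpleGraph (Fin n)
  B' : SimpleGraph (Fin n)

instance (n k : ℕ) : MeasurableSpace (ModifiedSample n k) := ⊤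

/-- The joint law of `(σ, π, G, G', A', B')`, where `A'` and `B'` are obtained from `G'` and `π`
as `A` and `B` are obtained from `G` and `π` in the original model. -/
def modifiedJointLaw (n k N : ℕ) [NeZero k] (lam ε s D : ℝ) : PMF (ModifiedSample n k) :=
  (PMF.uniformOfFintype (Fin n → Fin k)).bind fun σ =>
  (PMF.uniformOfFintype (Equiv.Perm (Fin n))).bind fun π =>
  (sbmGivenLabels n k lam ε σ).bind fun G =>
  (removalLaw n k N lam D G).bind fun G' =>
  (indepEdgeGraph n fun _ => s).bind fun J =>
  (indepEdgeGraph n fun _ => s).bind fun K =>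
  PMF.pure ⟨σ, π, G, G', G' ⊓ J, relabel π G' ⊓ K⟩

/-- The law of `(A', B')` in the modified model. -/
def modifiedPairLaw (n k N : ℕ) [NeZero k] (lam ε s D : ℝ) :
    Measure (SimpleGraph (Fin n) × SimpleGraph (Fin n)) :=
  (modifiedJointLaw n k N lam ε s D).toMeasure.map fun x => (x.A', x.B')

end

end CorrelatedSBM

/-! Removing one edge from each short cycle of a typical graph should give nearly the law of the
graph conditioned to have no short cycle. The proof tests this against a function `f` of the parent
graph with values in `[0, 1]`. Let `r S` be the mean of `f` after the removal procedure is applied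
to the graph with edge set `S`.

Call `S` spaced if it has no small bad part and its short cycles are edge-disjoint. On such `S` only
cycles trigger removals, and `r S` is the average of `r (S.erase e)` over the edges `e` of any one
cycle in `S` (`mean_removalLaw_step`). Let `level r m` be the part of the expectation of `r` carried
by spaced sets with exactly `m` cycles. Erasing an edge is reversible at the cost of an odds factor
`p / (1 - p)` (`sum_wt_remove`), so `(m + 1) * level r (m + 1)` is the `m`-cycle expectation of `r`
times the weight of the edges whose addition closes one more cycle while keeping the set spaced.
Without the spacing restriction this weight has mean exactly `mu`, the expected number of cycles.
Its variance tends to zero: disjoint cycles are uncorrelated, and every other pair costs an extra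
factor of order `1 / n`. The restriction costs little in mean (`avg_abs_spacedCompletions_sub_le`).
Hence `level r m` is close to `mu ^ m / m! * level r 0` (`abs_level_sub_le`), a factor that does not
depend on `f`.

Summing over `m ≤ M`, with Markov's inequality for the tail, the mean of `r` is close to `c * level
r 0` with `c` independent of `f` (`abs_avg_sub_mul_level_zero_le`), and `level r 0` is the mean of
`f` on the good event. Taking `f` to be the conditional probability of an observed event, and then
`f = 1` to identify `c`, gives the conditional law (`abs_sub_div_le`).

Two first-moment bounds make the errors vanish: small bad graphs occur with probability `O(1 / log
n)` (`sum_bad_le`), and distinct cycles sharing a vertex have weight `O(1 / n)`, as their union has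
more edges than vertices (`sum_near_shortCycle_le`). -/

namespace CorrelatedSBM

noncomputable section

open scoped Classical

set_option linter.unusedSectionVars false

/-! ### Random subsets with independent membership -/

section Weights

variable {ι : Type*} [Fintype ι] [DecidableEq ι]

/-- The probability of `S` when every `i` is included independently with probability `p i`. -/
def wt (p : ι → ℝ) (S : Finset ι) : ℝ := (∏ i ∈ S, p i) * ∏ i ∈ Sᶜ, (1 - p i)

lemma wt_nonneg {p : ι → ℝ} (h0 : ∀ i, 0 ≤ p i) (h1 : ∀ i, p i ≤ 1) (S : Finset ι) :
    0 ≤ wt p S :=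
  mul_nonneg (Finset.prod_nonneg fun i _ => h0 i)
    (Finset.prod_nonneg fun i _ => sub_nonneg.2 (h1 i))

lemma sum_wt (p : ι → ℝ) : ∑ S, wt p S = 1 := by
  simp only [wt]
  rw [← Fintype.prod_add p fun i => 1 - p i]
  simp

/-- The indicator is absorbed into the product by setting the forbidden factors to zero. The sum
over `S` then factorizes over coordinates, and those outside `A ∪ B` contribute `p i + (1 - p i) =
1`. -/
lemma sum_wt_subset_disjoint (p : ι → ℝ) {A B : Finset ι} (hAB : Disjoint A B) :
    ∑ S, wt p S * (if A ⊆ S ∧ Disjoint B S then 1 else 0) =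
      (∏ i ∈ A, p i) * ∏ i ∈ B, (1 - p i) := by
  have key : ∀ S : Finset ι, wt p S * (if A ⊆ S ∧ Disjoint B S then 1 else 0) =
      (∏ i ∈ S, if i ∈ B then 0 else p i) * ∏ i ∈ Sᶜ, if i ∈ A then 0 else 1 - p i := by
    intro S
    split_ifs with h
    · rw [mul_one, wt]
      congr 1
      · refine Finset.prod_congr rfl fun i hi => ?_
        rw [if_neg fun hB => Finset.disjoint_left.1 h.2 hB hi]
      · refine Finset.prod_congr rfl fun i hi => ?_
        rw [if_neg fun hA => Finset.mem_compl.1 hi (h.1 hA)]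
    · rw [mul_zero, eq_comm, mul_eq_zero]
      by_cases hA : A ⊆ S
      · left
        have : ¬ Disjoint B S := fun hB => h ⟨hA, hB⟩
        obtain ⟨i, hiB, hiS⟩ := Finset.not_disjoint_iff.1 this
        exact Finset.prod_eq_zero hiS (if_pos hiB)
      · right
        obtain ⟨i, hiA, hiS⟩ := Finset.not_subset.1 hA
        exact Finset.prod_eq_zero (Finset.mem_compl.2 hiS) (if_pos hiA)
  simp only [key]
  rw [← Fintype.prod_add (fun i => if i ∈ B then 0 else p i)
    (fun i => if i ∈ A then 0 else 1 - p i)]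
  have : ∀ i, ((if i ∈ B then 0 else p i) + if i ∈ A then 0 else 1 - p i) =
      (if i ∈ A then p i else 1) * if i ∈ B then 1 - p i else 1 := by
    intro i
    by_cases hA : i ∈ A
    · have hB : i ∉ B := Finset.disjoint_left.1 hAB hA
      simp [hA, hB]
    · by_cases hB : i ∈ B <;> simp [hA, hB]
  simp only [this, Finset.prod_mul_distrib, Finset.prod_ite_mem, Finset.univ_inter]

lemma sum_wt_subset (p : ι → ℝ) (A : Finset ι) :
    ∑ S, wt p S * (if A ⊆ S then 1 else 0) = ∏ i ∈ A, p i := by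
  simpa using sum_wt_subset_disjoint p (Finset.disjoint_empty_right A)

lemma wt_insert {p : ι → ℝ} {i : ι} (hp : p i ≠ 1) {S : Finset ι} (hi : i ∉ S) :
    wt p (insert i S) = wt p S * (p i / (1 - p i)) := by
  have h : 1 - p i ≠ 0 := sub_ne_zero.2 (Ne.symm hp)
  have hc : Sᶜ = insert i (insert i S)ᶜ := by
    ext j; by_cases hj : j = i
    · subst hj; simp [hi]
    · simp [hj]
  rw [wt, wt, Finset.prod_insert hi, hc, Finset.prod_insert (by simp)]
  field_simp

/-- Change of variables `S ↦ S.erase i`; the price of reinserting `i` is the odds `p i / (1 - p i)`.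
-/
lemma sum_wt_mem {p : ι → ℝ} {i : ι} (hp : p i ≠ 1) (h : Finset ι → ℝ) :
    ∑ S, wt p S * (if i ∈ S then h S else 0) =
      ∑ S, wt p S * (p i / (1 - p i)) * (if i ∉ S then h (insert i S) else 0) := by
  simp only [mul_ite, mul_zero, ← Finset.sum_filter]
  refine Finset.sum_bij' (fun S _ => S.erase i) (fun S _ => insert i S) ?_ ?_ ?_ ?_ ?_
  · intro S _; simp
  · intro S _; simp
  · intro S hS; exact Finset.insert_erase (Finset.mem_filter.1 hS).2
  · intro S hS; exact Finset.erase_insert (Finset.mem_filter.1 hS).2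
  · intro S hS
    rw [Finset.insert_erase (Finset.mem_filter.1 hS).2, ← wt_insert hp (by simp),
      Finset.insert_erase (Finset.mem_filter.1 hS).2]

end Weights

/-! ### Removing one element from every target contained in a random set -/

section Targets

variable {ι : Type*} [Fintype ι] [DecidableEq ι] {T : Type*} [Fintype T]

/-- The number of sets of the family `E` that are contained in `S`. -/
def numIn (E : T → Finset ι) (S : Finset ι) : ℕ := (Finset.univ.filter fun C => E C ⊆ S).card

/-- `S` has no bad part, and the members of `E` that it contains are pairwise disjoint. -/
def Spaced (Bad : Finset ι → Prop) (E : T → Finset ι) (S : Finset ι) : Prop :=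
  ¬ Bad S ∧ ∀ C C', C ≠ C' → E C ⊆ S → E C' ⊆ S → Disjoint (E C) (E C')

lemma numIn_eq_sum (E : T → Finset ι) (S : Finset ι) :
    (numIn E S : ℝ) = ∑ C, if E C ⊆ S then 1 else 0 := by
  simp [numIn]

lemma Spaced.mono {Bad : Finset ι → Prop} (hBad : Monotone Bad) {E : T → Finset ι}
    {S S' : Finset ι} (h : Spaced Bad E S) (hS : S' ⊆ S) : Spaced Bad E S' :=
  ⟨fun hb => h.1 (hBad hS hb),
    fun C C' hC h1 h2 => h.2 C C' hC (h1.trans hS) (h2.trans hS)⟩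

/-- Two targets completed by the same new element would both contain it, contrary to disjointness.
This is why an insertion moves between consecutive levels. -/
lemma Spaced.numIn_insert {Bad : Finset ι → Prop} {E : T → Finset ι} {e : ι} {g : Finset ι}
    (h : Spaced Bad E (insert e g)) (he : e ∉ g) {C : T} (heC : e ∈ E C)
    (hC : E C ⊆ insert e g) : numIn E (insert e g) = numIn E g + 1 := by
  have : (Finset.univ.filter fun C => E C ⊆ insert e g) =
      insert C (Finset.univ.filter fun C => E C ⊆ g) := by
    ext C'
    simp only [Finset.mem_filter, Finset.mem_univ, true_and, Finset.mem_insert]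
    constructor
    · intro h'
      by_cases hCC : C' = C
      · exact Or.inl hCC
      · right
        have hd := h.2 C' C hCC h' hC
        exact (Finset.subset_insert_iff_of_notMem fun h2 => Finset.disjoint_left.1 hd h2 heC).1 h'
    · rintro (rfl | h')
      · exact hC
      · exact h'.trans (Finset.subset_insert _ _)
  rw [numIn, this, Finset.card_insert_of_notMem, numIn]
  simp only [Finset.mem_filter, Finset.mem_univ, true_and]
  exact fun h' => he (h' heC)

/-- The weight with which adding one element to `g` completes the set `E C`. -/
def completion (p : ι → ℝ) (E : T → Finset ι) (C : T) (g : Finset ι) : ℝ :=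
  ∑ e ∈ E C, p e / (1 - p e) / (E C).card * if e ∉ g ∧ E C ⊆ insert e g then 1 else 0

/-- Choosing a target in a random set and removing one of its elements amounts to reweighting
the law of the remaining set. -/
lemma sum_wt_remove {p : ι → ℝ} (hp : ∀ i, p i ≠ 1) (E : T → Finset ι)
    (ψ : Finset ι → Finset ι → ℝ) :
    ∑ S, wt p S * ∑ C, (if E C ⊆ S then (∑ e ∈ E C, ψ S (S.erase e)) / (E C).card else 0) =
      ∑ g, wt p g * ∑ C, ∑ e ∈ E C, p e / (1 - p e) / (E C).card *
        if e ∉ g ∧ E C ⊆ insert e g then ψ (insert e g) g else 0 := by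
  have h1 : ∀ C : T, ∀ e ∈ E C,
      ∑ S, wt p S * (if E C ⊆ S then ψ S (S.erase e) / (E C).card else 0) =
        ∑ g, wt p g * (p e / (1 - p e) / (E C).card *
          if e ∉ g ∧ E C ⊆ insert e g then ψ (insert e g) g else 0) := by
    intro C e he
    have h2 := sum_wt_mem (hp e)
      (fun S => if E C ⊆ S then ψ S (S.erase e) / ((E C).card : ℝ) else 0)
    have h3 : ∀ S : Finset ι, (if e ∈ S then
        (if E C ⊆ S then ψ S (S.erase e) / ((E C).card : ℝ) else 0) else 0) =
        if E C ⊆ S then ψ S (S.erase e) / ((E C).card : ℝ) else 0 := by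
      intro S
      by_cases hS : E C ⊆ S
      · simp [hS he]
      · simp [hS]
    simp only [h3] at h2
    rw [h2]
    refine Finset.sum_congr rfl fun g _ => ?_
    by_cases heg : e ∈ g
    · simp [heg]
    · by_cases hC : E C ⊆ insert e g
      · simp only [heg, not_false_eq_true, hC, and_self, if_true, Finset.erase_insert heg]
        ring
      · simp [hC]
  calc _ = ∑ C, ∑ e ∈ E C,
        ∑ S, wt p S * (if E C ⊆ S then ψ S (S.erase e) / (E C).card else 0) := by
        simp only [Finset.mul_sum]
        rw [Finset.sum_comm]
        refine Finset.sum_congr rfl fun C _ => ?_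
        rw [Finset.sum_comm]
        refine Finset.sum_congr rfl fun S _ => ?_
        split_ifs
        · rw [Finset.sum_div, Finset.mul_sum]
        · simp
    _ = _ := by
        simp only [Finset.mul_sum]
        rw [Finset.sum_comm]
        refine Finset.sum_congr rfl fun C _ => ?_
        exact (Finset.sum_congr rfl fun e he => h1 C e he).trans Finset.sum_comm

/-- The total weight with which adding one element completes a target. -/
def completions (p : ι → ℝ) (E : T → Finset ι) (g : Finset ι) : ℝ := ∑ C, completion p E C g

/-- The part of `completions` in which the enlarged set is still spaced. -/
def spacedCompletions (Bad : Finset ι → Prop) (p : ι → ℝ) (E : T → Finset ι) (g : Finset ι) :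
    ℝ :=
  ∑ C, ∑ e ∈ E C, p e / (1 - p e) / (E C).card *
    if e ∉ g ∧ E C ⊆ insert e g then (if Spaced Bad E (insert e g) then 1 else 0) else 0

lemma sum_wt_completions {p : ι → ℝ} (hp : ∀ i, p i ≠ 1) {E : T → Finset ι}
    (hE : ∀ C, (E C).Nonempty) :
    ∑ g, wt p g * completions p E g = ∑ S, wt p S * numIn E S := by
  have h := sum_wt_remove hp E (fun _ _ => 1)
  simp only [completions, completion, numIn_eq_sum]
  rw [← h]
  refine Finset.sum_congr rfl fun S _ => ?_
  congr 1
  refine Finset.sum_congr rfl fun C _ => ?_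
  have : ((E C).card : ℝ) ≠ 0 := by exact_mod_cast (hE C).card_pos.ne'
  simp [this]

/-- The removal identity with the indicator that the larger set is not spaced. It turns the loss in
the completion weight into an expectation over `S`, to which Cauchy–Schwarz applies. -/
lemma sum_wt_completions_sub {p : ι → ℝ} (hp : ∀ i, p i ≠ 1) {E : T → Finset ι}
    (hE : ∀ C, (E C).Nonempty) (Bad : Finset ι → Prop) :
    ∑ g, wt p g * (completions p E g - spacedCompletions Bad p E g) =
      ∑ S, wt p S * (numIn E S * if Spaced Bad E S then 0 else 1) := by
  have h := sum_wt_remove hp E (fun S _ => if Spaced Bad E S then 0 else 1)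
  have h2 : ∀ g, completions p E g - spacedCompletions Bad p E g =
      ∑ C, ∑ e ∈ E C, p e / (1 - p e) / (E C).card *
        if e ∉ g ∧ E C ⊆ insert e g then (if Spaced Bad E (insert e g) then 0 else 1) else 0 := by
    intro g
    simp only [completions, completion, spacedCompletions, ← Finset.sum_sub_distrib, ← mul_sub]
    refine Finset.sum_congr rfl fun C _ => Finset.sum_congr rfl fun e _ => ?_
    split_ifs <;> simp
  simp only [h2]
  rw [← h]
  refine Finset.sum_congr rfl fun S _ => ?_
  rw [numIn_eq_sum, Finset.sum_mul]
  congr 1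
  refine Finset.sum_congr rfl fun C _ => ?_
  have : ((E C).card : ℝ) ≠ 0 := by exact_mod_cast (hE C).card_pos.ne'
  split_ifs <;> simp [this]

lemma spacedCompletions_le {p : ι → ℝ} (h0 : ∀ i, 0 ≤ p i) (h1 : ∀ i, p i < 1)
    (E : T → Finset ι) (Bad : Finset ι → Prop) (g : Finset ι) :
    spacedCompletions Bad p E g ≤ completions p E g := by
  refine Finset.sum_le_sum fun C _ => Finset.sum_le_sum fun e _ => ?_
  have : 0 ≤ p e / (1 - p e) / (E C).card :=
    div_nonneg (div_nonneg (h0 e) (sub_pos.2 (h1 e)).le) (Nat.cast_nonneg _)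
  refine mul_le_mul_of_nonneg_left ?_ this
  split_ifs <;> norm_num

/-- The removal recursion between configurations with `m + 1` and with `m` targets. -/
lemma sum_wt_level_succ {p : ι → ℝ} (hp : ∀ i, p i ≠ 1) {E : T → Finset ι}
    {Bad : Finset ι → Prop} (hBad : Monotone Bad) {r : Finset ι → ℝ}
    (hr : ∀ S C, Spaced Bad E S → E C ⊆ S →
      r S = (∑ e ∈ E C, r (S.erase e)) / (E C).card) (m : ℕ) :
    (m + 1) * ∑ S, wt p S * (if Spaced Bad E S ∧ numIn E S = m + 1 then r S else 0) =
      ∑ g, wt p g * ((if Spaced Bad E g ∧ numIn E g = m then r g else 0) *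
        spacedCompletions Bad p E g) := by
  have h := sum_wt_remove hp E
    (fun S g => if Spaced Bad E S ∧ numIn E S = m + 1 then r g else 0)
  calc _ = ∑ S, wt p S * ∑ C, (if E C ⊆ S then (∑ e ∈ E C,
        if Spaced Bad E S ∧ numIn E S = m + 1 then r (S.erase e) else 0) / (E C).card else 0) := by
        rw [Finset.mul_sum]
        refine Finset.sum_congr rfl fun S _ => ?_
        rw [mul_left_comm]
        congr 1
        by_cases hS : Spaced Bad E S ∧ numIn E S = m + 1
        · simp only [hS, and_self, if_true]
          -- Each of the `m + 1` targets in `S` reproduces `r S`, which is where the factor `m + 1`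
          -- comes from.
          have h1 : ∀ C : T, (if E C ⊆ S then (∑ e ∈ E C, r (S.erase e)) / ((E C).card : ℝ)
              else 0) = (if E C ⊆ S then 1 else 0) * r S := by
            intro C
            split_ifs with hC
            · rw [one_mul, hr S C hS.1 hC]
            · simp
          simp only [h1]
          rw [← Finset.sum_mul, ← numIn_eq_sum, hS.2]
          push_cast
          ring
        · simp [hS]
    _ = _ := by
        rw [h]
        refine Finset.sum_congr rfl fun g _ => ?_
        congr 1
        rw [spacedCompletions, Finset.mul_sum]
        refine Finset.sum_congr rfl fun C _ => ?_
        rw [Finset.mul_sum]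
        refine Finset.sum_congr rfl fun e he => ?_
        rw [mul_left_comm]
        congr 1
        by_cases hc : e ∉ g ∧ E C ⊆ insert e g
        · by_cases hs : Spaced Bad E (insert e g)
          · have h1 := hs.numIn_insert hc.1 he hc.2
            have h2 := hs.mono hBad (Finset.subset_insert e g)
            simp [hc, hs, h1, h2]
          · simp [hs]
        · rw [if_neg hc, if_neg hc, mul_zero]

end Targets

/-! ### Second moments of the completion weights. -/

section Completion

variable {ι : Type*} [Fintype ι] [DecidableEq ι] {T : Type*} [Fintype T]

lemma completion_mul_indicator_iff {E : T → Finset ι} {C C' : T} {e e' : ι} {g : Finset ι} :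
    ((e ∉ g ∧ E C ⊆ insert e g) ∧ (e' ∉ g ∧ E C' ⊆ insert e' g)) ↔
      (E C).erase e ∪ (E C').erase e' ⊆ g ∧ Disjoint {e, e'} g := by
  rw [Finset.union_subset_iff, Finset.subset_insert_iff, Finset.subset_insert_iff,
    Finset.disjoint_insert_left, Finset.disjoint_singleton_left]
  tauto

lemma completion_mul (p : ι → ℝ) (E : T → Finset ι) (C C' : T) (g : Finset ι) :
    completion p E C g * completion p E C' g =
      ∑ e ∈ E C, ∑ e' ∈ E C', p e / (1 - p e) / (E C).card * (p e' / (1 - p e') / (E C').card) *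
        if (E C).erase e ∪ (E C').erase e' ⊆ g ∧ Disjoint {e, e'} g then 1 else 0 := by
  rw [completion, completion, Finset.sum_mul_sum]
  refine Finset.sum_congr rfl fun e _ => Finset.sum_congr rfl fun e' _ => ?_
  rw [mul_mul_mul_comm]
  congr 1
  simp only [← completion_mul_indicator_iff, ite_and]
  split_ifs <;> simp

lemma sum_wt_completion_mul (p : ι → ℝ) (E : T → Finset ι) (C C' : T) :
    ∑ g, wt p g * (completion p E C g * completion p E C' g) =
      ∑ e ∈ E C, ∑ e' ∈ E C', p e / (1 - p e) / (E C).card * (p e' / (1 - p e') / (E C').card) *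
        ∑ g, wt p g * if (E C).erase e ∪ (E C').erase e' ⊆ g ∧ Disjoint {e, e'} g
          then 1 else 0 := by
  simp only [completion_mul, Finset.mul_sum]
  rw [Finset.sum_comm]
  refine Finset.sum_congr rfl fun e _ => ?_
  rw [Finset.sum_comm]
  refine Finset.sum_congr rfl fun e' _ => Finset.sum_congr rfl fun g _ => ?_
  ring

/-- For disjoint targets the absent elements `e`, `e'` have probability `(1 - p e) * (1 - p e')`,
which cancels the denominators of the odds. Every choice of `e`, `e'` then contributes equally, and
the result is exact. -/
lemma sum_wt_completion_mul_of_disjoint {p : ι → ℝ} (hp : ∀ i, p i ≠ 1) {E : T → Finset ι}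
    {C C' : T} (hC : (E C).Nonempty) (hC' : (E C').Nonempty) (hd : Disjoint (E C) (E C')) :
    ∑ g, wt p g * (completion p E C g * completion p E C' g) =
      (∏ i ∈ E C, p i) * ∏ i ∈ E C', p i := by
  have hc : ((E C).card : ℝ) ≠ 0 := by exact_mod_cast hC.card_pos.ne'
  have hc' : ((E C').card : ℝ) ≠ 0 := by exact_mod_cast hC'.card_pos.ne'
  rw [sum_wt_completion_mul]
  have : ∀ e ∈ E C, ∀ e' ∈ E C',
      p e / (1 - p e) / (E C).card * (p e' / (1 - p e') / (E C').card) *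
        (∑ g, wt p g * if (E C).erase e ∪ (E C').erase e' ⊆ g ∧ Disjoint {e, e'} g
          then 1 else 0) =
      ((∏ i ∈ E C, p i) * ∏ i ∈ E C', p i) / ((E C).card * (E C').card) := by
    intro e he e' he'
    have hne : e ≠ e' := fun h => Finset.disjoint_left.1 hd he (h ▸ he')
    have h1 : e ∉ E C' := Finset.disjoint_left.1 hd he
    have h2 : e' ∉ E C := Finset.disjoint_right.1 hd he'
    rw [sum_wt_subset_disjoint, Finset.prod_pair hne, Finset.prod_union,
      ← Finset.mul_prod_erase _ _ he, ← Finset.mul_prod_erase _ _ he']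
    · have := sub_ne_zero.2 (hp e).symm
      have := sub_ne_zero.2 (hp e').symm
      field_simp
    · exact hd.mono (Finset.erase_subset _ _) (Finset.erase_subset _ _)
    · rw [Finset.disjoint_insert_right, Finset.disjoint_singleton_right]
      simp [h1, h2]
  rw [Finset.sum_congr rfl fun e he => Finset.sum_congr rfl fun e' he' => this e he e' he']
  simp only [Finset.sum_const, nsmul_eq_mul]
  field_simp

/-- Each odds factor is at most `2 * x`, because `x ≤ 1 / 2`, and the elements that must be present
contribute `x` each. The two odds factors account for the `+ 2` in the hypothesis on `m`, also when
`e = e'`. -/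
lemma sum_wt_completion_mul_le {p : ι → ℝ} {x : ℝ} (h0 : ∀ i, 0 ≤ p i) (hx : ∀ i, p i ≤ x)
    (hx0 : 0 ≤ x) (hx1 : x ≤ 1 / 2) {E : T → Finset ι} {C C' : T} (hC : (E C).Nonempty)
    (hC' : (E C').Nonempty) {m : ℕ} (hm : ∀ e ∈ E C, ∀ e' ∈ E C',
      m ≤ ((E C).erase e ∪ (E C').erase e').card + 2) :
    ∑ g, wt p g * (completion p E C g * completion p E C' g) ≤ 4 * x ^ m := by
  have hc : ((E C).card : ℝ) ≠ 0 := by exact_mod_cast hC.card_pos.ne'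
  have hc' : ((E C').card : ℝ) ≠ 0 := by exact_mod_cast hC'.card_pos.ne'
  have h1 : ∀ i, p i ≤ 1 := fun i => (hx i).trans (by linarith)
  have hq : ∀ i, p i / (1 - p i) ≤ 2 * x := by
    intro i
    have := hx i
    rw [div_le_iff₀ (by linarith)]
    nlinarith [h0 i]
  have hq0 : ∀ i, 0 ≤ p i / (1 - p i) := fun i => div_nonneg (h0 i) (sub_nonneg.2 (h1 i))
  rw [sum_wt_completion_mul]
  calc _ ≤ ∑ e ∈ E C, ∑ e' ∈ E C', 4 * x ^ m / ((E C).card * (E C').card) := by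
        refine Finset.sum_le_sum fun e he => Finset.sum_le_sum fun e' he' => ?_
        set A := (E C).erase e ∪ (E C').erase e'
        have hA : ∑ g, wt p g * (if A ⊆ g ∧ Disjoint {e, e'} g then (1 : ℝ) else 0) ≤
            x ^ A.card := by
          calc _ ≤ ∑ g, wt p g * (if A ⊆ g then (1 : ℝ) else 0) := by
                refine Finset.sum_le_sum fun g _ =>
                  mul_le_mul_of_nonneg_left ?_ (wt_nonneg h0 h1 g)
                split_ifs <;> simp_all
            _ = ∏ i ∈ A, p i := sum_wt_subset p A
            _ ≤ x ^ A.card := by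
                rw [← Finset.prod_const]
                exact Finset.prod_le_prod (fun i _ => h0 i) fun i _ => hx i
        have hA0 : 0 ≤ ∑ g, wt p g * (if A ⊆ g ∧ Disjoint {e, e'} g then (1 : ℝ) else 0) :=
          Finset.sum_nonneg fun g _ => mul_nonneg (wt_nonneg h0 h1 g) (by split_ifs <;> norm_num)
        have hpow : x ^ (A.card + 2) ≤ x ^ m :=
          pow_le_pow_of_le_one hx0 (by linarith) (hm e he e' he')
        calc _ ≤ 2 * x / (E C).card * (2 * x / (E C').card) * x ^ A.card := by
              have := hq e
              have := hq e'
              have := hq0 e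
              have := hq0 e'
              gcongr
          _ = 4 * x ^ (A.card + 2) / ((E C).card * (E C').card) := by
              field_simp; ring
          _ ≤ _ := by gcongr
    _ = 4 * x ^ m := by
        simp only [Finset.sum_const, nsmul_eq_mul]
        field_simp

end Completion

/-! ### The abstract target model: moments, fluctuations and the recursion over levels. -/

/-- A random label `σ` with law `u`, a random subset of `ι` whose members are, given `σ`,
included independently with probabilities `p σ i ≤ x`, and a finite family of targets `E C`, with a
relation `near` such that targets that are not near depend on independent parts of the model. -/
structure TargetModel (ι T Λ : Type*) [Fintype ι] [DecidableEq ι] [Fintype T] [Fintype Λ] where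
  u : Λ → ℝ
  p : Λ → ι → ℝ
  x : ℝ
  E : T → Finset ι
  Bad : Finset ι → Prop
  near : T → T → Prop
  u_nonneg : ∀ σ, 0 ≤ u σ
  sum_u : ∑ σ, u σ = 1
  p_nonneg : ∀ σ i, 0 ≤ p σ i
  p_le : ∀ σ i, p σ i ≤ x
  x_nonneg : 0 ≤ x
  x_le : x ≤ 1 / 2
  nonempty : ∀ C, (E C).Nonempty
  mono : Monotone Bad
  disjoint : ∀ C C', ¬ near C C' → Disjoint (E C) (E C')
  indep : ∀ C C', ¬ near C C' →
    ∑ σ, u σ * ((∏ i ∈ E C, p σ i) * ∏ i ∈ E C', p σ i) =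
      (∑ σ, u σ * ∏ i ∈ E C, p σ i) * ∑ σ, u σ * ∏ i ∈ E C', p σ i

namespace TargetModel

variable {ι T Λ : Type*} [Fintype ι] [DecidableEq ι] [Fintype T] [Fintype Λ]
  (𝓜 : TargetModel ι T Λ)

/-- The expectation of a function of the label and of the random set. -/
def avg (h : Λ → Finset ι → ℝ) : ℝ := ∑ σ, 𝓜.u σ * ∑ S, wt (𝓜.p σ) S * h σ S

/-- The weighted number of targets. -/
def kappa : ℝ := ∑ C, 𝓜.x ^ (𝓜.E C).card

/-- The weighted number of pairs of distinct targets that are near each other. -/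
def rho : ℝ := ∑ C, ∑ C', if 𝓜.near C C' ∧ C ≠ C' then 𝓜.x ^ (𝓜.E C ∪ 𝓜.E C').card else 0

/-- The probability of a bad configuration. -/
def badProb : ℝ := 𝓜.avg fun _ S => if 𝓜.Bad S then 1 else 0

/-- The mean number of targets. -/
def mu : ℝ := 𝓜.avg fun _ S => numIn 𝓜.E S

lemma p_le_one (σ : Λ) (i : ι) : 𝓜.p σ i ≤ 1 := by
  linarith [𝓜.p_le σ i, 𝓜.x_le]

lemma p_lt_one (σ : Λ) (i : ι) : 𝓜.p σ i < 1 := by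
  linarith [𝓜.p_le σ i, 𝓜.x_le]

lemma p_ne_one (σ : Λ) (i : ι) : 𝓜.p σ i ≠ 1 := (𝓜.p_lt_one σ i).ne

lemma weight_nonneg (σ : Λ) (S : Finset ι) : 0 ≤ 𝓜.u σ * wt (𝓜.p σ) S :=
  mul_nonneg (𝓜.u_nonneg σ) (wt_nonneg (𝓜.p_nonneg σ) (𝓜.p_le_one σ) S)

lemma avg_eq_sum (h : Λ → Finset ι → ℝ) :
    𝓜.avg h = ∑ z : Λ × Finset ι, 𝓜.u z.1 * wt (𝓜.p z.1) z.2 * h z.1 z.2 := by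
  simp only [avg, Finset.mul_sum, Fintype.sum_prod_type, mul_assoc]

lemma avg_mono {h k : Λ → Finset ι → ℝ} (hk : ∀ σ S, h σ S ≤ k σ S) : 𝓜.avg h ≤ 𝓜.avg k := by
  simp only [avg_eq_sum]
  exact Finset.sum_le_sum fun z _ =>
    mul_le_mul_of_nonneg_left (hk z.1 z.2) (𝓜.weight_nonneg z.1 z.2)

lemma avg_congr {h k : Λ → Finset ι → ℝ}
    (hk : ∀ σ, ∑ S, wt (𝓜.p σ) S * h σ S = ∑ S, wt (𝓜.p σ) S * k σ S) : 𝓜.avg h = 𝓜.avg k := by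
  simp only [avg, hk]

lemma avg_add (h k : Λ → Finset ι → ℝ) :
    𝓜.avg (fun σ S => h σ S + k σ S) = 𝓜.avg h + 𝓜.avg k := by
  simp only [avg_eq_sum, mul_add, Finset.sum_add_distrib]

lemma avg_sub (h k : Λ → Finset ι → ℝ) :
    𝓜.avg (fun σ S => h σ S - k σ S) = 𝓜.avg h - 𝓜.avg k := by
  simp only [avg_eq_sum, mul_sub, Finset.sum_sub_distrib]

lemma avg_const_mul (c : ℝ) (h : Λ → Finset ι → ℝ) :
    𝓜.avg (fun σ S => c * h σ S) = c * 𝓜.avg h := by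
  simp only [avg_eq_sum, Finset.mul_sum, mul_left_comm]

lemma avg_sum {α : Type*} (s : Finset α) (h : α → Λ → Finset ι → ℝ) :
    𝓜.avg (fun σ S => ∑ a ∈ s, h a σ S) = ∑ a ∈ s, 𝓜.avg (h a) := by
  simp only [avg_eq_sum, Finset.mul_sum]
  rw [Finset.sum_comm]

lemma avg_const (c : ℝ) : 𝓜.avg (fun _ _ => c) = c := by
  simp only [avg, ← Finset.sum_mul, sum_wt, one_mul, 𝓜.sum_u]

lemma avg_nonneg {h : Λ → Finset ι → ℝ} (hh : ∀ σ S, 0 ≤ h σ S) : 0 ≤ 𝓜.avg h := by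
  rw [← 𝓜.avg_const 0]; exact 𝓜.avg_mono hh

lemma abs_avg_le (h : Λ → Finset ι → ℝ) : |𝓜.avg h| ≤ 𝓜.avg fun σ S => |h σ S| := by
  simp only [avg_eq_sum]
  refine (Finset.abs_sum_le_sum_abs _ _).trans_eq (Finset.sum_congr rfl fun z _ => ?_)
  rw [abs_mul, abs_of_nonneg (𝓜.weight_nonneg z.1 z.2)]

lemma avg_mul_sq_le (h k : Λ → Finset ι → ℝ) :
    𝓜.avg (fun σ S => h σ S * k σ S) ^ 2 ≤
      𝓜.avg (fun σ S => h σ S ^ 2) * 𝓜.avg (fun σ S => k σ S ^ 2) := by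
  simp only [avg_eq_sum]
  refine Finset.sum_sq_le_sum_mul_sum_of_sq_le_mul _ ?_ ?_ ?_
  · exact fun z _ => mul_nonneg (𝓜.weight_nonneg z.1 z.2) (sq_nonneg _)
  · exact fun z _ => mul_nonneg (𝓜.weight_nonneg z.1 z.2) (sq_nonneg _)
  · exact fun z _ => le_of_eq (by ring)

lemma avg_indicator_subset (A : Finset ι) :
    𝓜.avg (fun _ S => if A ⊆ S then 1 else 0) = ∑ σ, 𝓜.u σ * ∏ i ∈ A, 𝓜.p σ i := by
  simp only [avg, sum_wt_subset]

lemma sum_u_mul_le {h : Λ → ℝ} {c : ℝ} (hh : ∀ σ, h σ ≤ c) : ∑ σ, 𝓜.u σ * h σ ≤ c := by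
  calc _ ≤ ∑ σ, 𝓜.u σ * c :=
        Finset.sum_le_sum fun σ _ => mul_le_mul_of_nonneg_left (hh σ) (𝓜.u_nonneg σ)
    _ = c := by rw [← Finset.sum_mul, 𝓜.sum_u, one_mul]

lemma prod_p_le (σ : Λ) (A : Finset ι) : ∏ i ∈ A, 𝓜.p σ i ≤ 𝓜.x ^ A.card := by
  rw [← Finset.prod_const]
  exact Finset.prod_le_prod (fun i _ => 𝓜.p_nonneg σ i) fun i _ => 𝓜.p_le σ i

lemma avg_indicator_subset_le (A : Finset ι) :
    𝓜.avg (fun _ S => if A ⊆ S then 1 else 0) ≤ 𝓜.x ^ A.card := by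
  rw [avg_indicator_subset]
  exact 𝓜.sum_u_mul_le fun σ => 𝓜.prod_p_le σ A

lemma kappa_nonneg : 0 ≤ 𝓜.kappa := Finset.sum_nonneg fun _ _ => pow_nonneg 𝓜.x_nonneg _

lemma rho_nonneg : 0 ≤ 𝓜.rho := by
  refine Finset.sum_nonneg fun _ _ => Finset.sum_nonneg fun _ _ => ?_
  have := 𝓜.x_nonneg
  split_ifs <;> positivity

lemma badProb_nonneg : 0 ≤ 𝓜.badProb := 𝓜.avg_nonneg fun _ _ => by split_ifs <;> norm_num

lemma mu_eq : 𝓜.mu = ∑ C, ∑ σ, 𝓜.u σ * ∏ i ∈ 𝓜.E C, 𝓜.p σ i := by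
  simp only [mu, numIn_eq_sum, avg_sum, avg_indicator_subset]

lemma mu_nonneg : 0 ≤ 𝓜.mu := 𝓜.avg_nonneg fun _ _ => Nat.cast_nonneg _

lemma mu_le_kappa : 𝓜.mu ≤ 𝓜.kappa := by
  simp only [mu, numIn_eq_sum, avg_sum, kappa]
  exact Finset.sum_le_sum fun C _ => 𝓜.avg_indicator_subset_le _

/-- Sums over pairs of targets, split into equal, near and independent ones. -/
lemma sum_pairs_le {f : T → T → ℝ} {a b : ℝ} {q : T → ℝ} (hq : ∀ C, 0 ≤ q C)
    {y : T → ℝ} (h1 : ∀ C, f C C ≤ a * y C)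
    (h2 : ∀ C C', C ≠ C' → f C C' ≤ b * 𝓜.x ^ (𝓜.E C ∪ 𝓜.E C').card)
    (h3 : ∀ C C', ¬ 𝓜.near C C' → f C C' ≤ q C * q C') :
    ∑ C, ∑ C', f C C' ≤ a * ∑ C, y C + b * 𝓜.rho + (∑ C, q C) ^ 2 := by
  have key : ∀ C C', f C C' ≤ (if C' = C then a * y C else 0) +
      b * (if 𝓜.near C C' ∧ C ≠ C' then 𝓜.x ^ (𝓜.E C ∪ 𝓜.E C').card else 0) + q C * q C' := by
    intro C C'
    have := mul_nonneg (hq C) (hq C')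
    by_cases hC : C' = C
    · subst hC
      simpa using (h1 C').trans (by linarith)
    · by_cases hn : 𝓜.near C C'
      · have := h2 C C' (Ne.symm hC)
        simp only [hC, if_false, hn, true_and, ne_eq, Ne.symm hC, not_false_eq_true, if_true]
        linarith
      · simpa [hC, hn] using h3 C C' hn
  calc _ ≤ ∑ C, ∑ C', ((if C' = C then a * y C else 0) +
      b * (if 𝓜.near C C' ∧ C ≠ C' then 𝓜.x ^ (𝓜.E C ∪ 𝓜.E C').card else 0) + q C * q C') :=
        Finset.sum_le_sum fun C _ => Finset.sum_le_sum fun C' _ => key C C'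
    _ = _ := by
        simp only [Finset.sum_add_distrib, Finset.sum_ite_eq', Finset.mem_univ, if_true,
          ← Finset.mul_sum, rho, sq, ← Finset.sum_mul]

lemma avg_numIn_sq_le :
    𝓜.avg (fun _ S => (numIn 𝓜.E S : ℝ) ^ 2) ≤ 𝓜.kappa + 𝓜.rho + 𝓜.kappa ^ 2 := by
  have h : 𝓜.avg (fun _ S => (numIn 𝓜.E S : ℝ) ^ 2) =
      ∑ C, ∑ C', 𝓜.avg (fun _ S => if 𝓜.E C ∪ 𝓜.E C' ⊆ S then 1 else 0) := by
    simp only [← avg_sum]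
    congr
    funext _ S
    rw [numIn_eq_sum, sq, Finset.sum_mul_sum]
    refine Finset.sum_congr rfl fun C _ => Finset.sum_congr rfl fun C' _ => ?_
    simp only [Finset.union_subset_iff]
    split_ifs <;> simp_all
  rw [h]
  refine (𝓜.sum_pairs_le (a := 1) (b := 1) (q := fun C => 𝓜.x ^ (𝓜.E C).card)
    (y := fun C => 𝓜.x ^ (𝓜.E C).card)
    (fun C => pow_nonneg 𝓜.x_nonneg _) (fun C => ?_) (fun C C' _ => ?_) fun C C' hn => ?_).trans_eq
    (by simp [kappa])
  · simpa using 𝓜.avg_indicator_subset_le (𝓜.E C)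
  · simpa using 𝓜.avg_indicator_subset_le (𝓜.E C ∪ 𝓜.E C')
  · rw [← pow_add, ← Finset.card_union_of_disjoint (𝓜.disjoint C C' hn)]
    exact 𝓜.avg_indicator_subset_le (𝓜.E C ∪ 𝓜.E C')

/-- Union bound: a set that is not spaced is bad or contains two distinct intersecting targets, and
intersecting targets are near. -/
lemma avg_not_spaced_le :
    𝓜.avg (fun _ S => if Spaced 𝓜.Bad 𝓜.E S then 0 else 1) ≤ 𝓜.badProb + 𝓜.rho := by
  have h : ∀ S, (if Spaced 𝓜.Bad 𝓜.E S then (0 : ℝ) else 1) ≤ (if 𝓜.Bad S then 1 else 0) +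
      ∑ C, ∑ C', if 𝓜.near C C' ∧ C ≠ C' then
        (if 𝓜.E C ∪ 𝓜.E C' ⊆ S then (1 : ℝ) else 0) else 0 := by
    intro S
    have hpos : ∀ C C', (0 : ℝ) ≤ if 𝓜.near C C' ∧ C ≠ C' then
        (if 𝓜.E C ∪ 𝓜.E C' ⊆ S then (1 : ℝ) else 0) else 0 := by
      intro C C'; split_ifs <;> norm_num
    have hsum := Finset.sum_nonneg fun C (_ : C ∈ Finset.univ) =>
      Finset.sum_nonneg fun C' (_ : C' ∈ Finset.univ) => hpos C C'
    by_cases hS : Spaced 𝓜.Bad 𝓜.E S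
    · rw [if_pos hS]
      exact add_nonneg (by split_ifs <;> norm_num) hsum
    · rw [if_neg hS]
      by_cases hb : 𝓜.Bad S
      · rw [if_pos hb]; linarith
      · have : ∃ C C', C ≠ C' ∧ 𝓜.E C ⊆ S ∧ 𝓜.E C' ⊆ S ∧ ¬ Disjoint (𝓜.E C) (𝓜.E C') := by
          by_contra! hcon
          exact hS ⟨hb, hcon⟩
        obtain ⟨C, C', hne, h1, h2, h3⟩ := this
        have hn : 𝓜.near C C' := by
          by_contra hn; exact h3 (𝓜.disjoint C C' hn)
        have := (Finset.single_le_sum (fun C' _ => hpos C C') (Finset.mem_univ C')).trans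
          (Finset.single_le_sum (f := fun C => ∑ C', if 𝓜.near C C' ∧ C ≠ C' then
            (if 𝓜.E C ∪ 𝓜.E C' ⊆ S then (1 : ℝ) else 0) else 0)
            (fun C _ => Finset.sum_nonneg fun C' _ => hpos C C') (Finset.mem_univ C))
        rw [if_pos ⟨hn, hne⟩, if_pos (Finset.union_subset h1 h2)] at this
        rw [if_neg hb]
        linarith
  refine (𝓜.avg_mono fun _ S => h S).trans ?_
  rw [avg_add]
  refine add_le_add le_rfl ?_
  simp only [avg_sum, rho]
  refine Finset.sum_le_sum fun C _ => Finset.sum_le_sum fun C' _ => ?_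
  split_ifs with hc
  · exact 𝓜.avg_indicator_subset_le _
  · exact (𝓜.avg_const 0).le

lemma avg_completions : 𝓜.avg (fun σ g => completions (𝓜.p σ) 𝓜.E g) = 𝓜.mu :=
  𝓜.avg_congr fun σ => sum_wt_completions (𝓜.p_ne_one σ) 𝓜.nonempty

/-- Unlike for `numIn`, the diagonal is negligible: completing the same target twice needs at least
`(E C).card - 1` present elements and brings two odds factors, hence one surplus power of `x`. Pairs
that are not near give exact products by `indep`, and these sum to at most `mu ^ 2`. -/
lemma avg_completions_sq_le :
    𝓜.avg (fun σ g => completions (𝓜.p σ) 𝓜.E g ^ 2) ≤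
      4 * (𝓜.x * 𝓜.kappa) + 4 * 𝓜.rho + 𝓜.mu ^ 2 := by
  have h : 𝓜.avg (fun σ g => completions (𝓜.p σ) 𝓜.E g ^ 2) = ∑ C, ∑ C',
      𝓜.avg (fun σ g => completion (𝓜.p σ) 𝓜.E C g * completion (𝓜.p σ) 𝓜.E C' g) := by
    simp only [← avg_sum, completions, sq, Finset.sum_mul_sum]
  have hle : ∀ C C' m, (∀ e ∈ 𝓜.E C, ∀ e' ∈ 𝓜.E C',
      m ≤ ((𝓜.E C).erase e ∪ (𝓜.E C').erase e').card + 2) →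
      𝓜.avg (fun σ g => completion (𝓜.p σ) 𝓜.E C g * completion (𝓜.p σ) 𝓜.E C' g) ≤
        4 * 𝓜.x ^ m := fun C C' m hm =>
    𝓜.sum_u_mul_le fun σ => sum_wt_completion_mul_le (𝓜.p_nonneg σ) (𝓜.p_le σ) 𝓜.x_nonneg
      𝓜.x_le (𝓜.nonempty C) (𝓜.nonempty C') hm
  rw [h, mu_eq]
  refine (𝓜.sum_pairs_le (a := 4) (b := 4) (q := fun C => ∑ σ, 𝓜.u σ * ∏ i ∈ 𝓜.E C, 𝓜.p σ i)
    (y := fun C => 𝓜.x ^ ((𝓜.E C).card + 1)) (fun C => ?_) (fun C => ?_) (fun C C' _ => ?_)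
    fun C C' hn => ?_).trans_eq ?_
  · exact Finset.sum_nonneg fun σ _ => mul_nonneg (𝓜.u_nonneg σ)
      (Finset.prod_nonneg fun i _ => 𝓜.p_nonneg σ i)
  · refine hle C C _ fun e he e' he' => ?_
    have h1 := Finset.card_le_card
      (Finset.subset_union_left (s₁ := (𝓜.E C).erase e) (s₂ := (𝓜.E C).erase e'))
    have h2 := Finset.card_erase_add_one he
    omega
  · refine hle C C' _ fun e he e' he' => ?_
    have h1 : 𝓜.E C ∪ 𝓜.E C' ⊆ ((𝓜.E C).erase e ∪ (𝓜.E C').erase e') ∪ {e, e'} := by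
      intro i hi
      simp only [Finset.mem_union, Finset.mem_erase, Finset.mem_insert,
        Finset.mem_singleton] at hi ⊢
      tauto
    refine (Finset.card_le_card h1).trans ((Finset.card_union_le _ _).trans ?_)
    exact Nat.add_le_add_left Finset.card_le_two _
  · rw [← 𝓜.indep C C' hn, avg]
    refine (Finset.sum_congr rfl fun σ _ => ?_).le
    rw [sum_wt_completion_mul_of_disjoint (𝓜.p_ne_one σ) (𝓜.nonempty C) (𝓜.nonempty C')
      (𝓜.disjoint C C' hn)]
  · simp only [kappa, Finset.mul_sum, pow_succ']

/-- The bound for the fluctuations of the completion weight. -/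
def fluct : ℝ := √((𝓜.kappa + 𝓜.rho + 𝓜.kappa ^ 2) * (𝓜.badProb + 𝓜.rho)) +
  √(4 * (𝓜.x * 𝓜.kappa) + 4 * 𝓜.rho)

lemma fluct_nonneg : 0 ≤ 𝓜.fluct := add_nonneg (Real.sqrt_nonneg _) (Real.sqrt_nonneg _)

lemma avg_abs_spacedCompletions_sub_le :
    𝓜.avg (fun σ g => |spacedCompletions 𝓜.Bad (𝓜.p σ) 𝓜.E g - 𝓜.mu|) ≤ 𝓜.fluct := by
  have h1 : 𝓜.avg (fun σ g => |completions (𝓜.p σ) 𝓜.E g - 𝓜.mu|) ≤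
      √(4 * (𝓜.x * 𝓜.kappa) + 4 * 𝓜.rho) := by
    -- The first absolute moment is bounded by the standard deviation, Cauchy–Schwarz being used
    -- with the constant function `1`.
    refine Real.le_sqrt_of_sq_le ?_
    have h := 𝓜.avg_mul_sq_le (fun σ g => |completions (𝓜.p σ) 𝓜.E g - 𝓜.mu|) fun _ _ => 1
    simp only [mul_one, one_pow, avg_const, sq_abs] at h
    refine h.trans ?_
    have h2 : ∀ σ g, (completions (𝓜.p σ) 𝓜.E g - 𝓜.mu) ^ 2 =
        (completions (𝓜.p σ) 𝓜.E g ^ 2 - 2 * 𝓜.mu * completions (𝓜.p σ) 𝓜.E g) + 𝓜.mu ^ 2 :=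
      fun σ g => by ring
    simp only [h2, avg_add, avg_sub, avg_const_mul, avg_completions, avg_const]
    nlinarith [𝓜.avg_completions_sq_le]
  have h2 : 𝓜.avg (fun σ g =>
      completions (𝓜.p σ) 𝓜.E g - spacedCompletions 𝓜.Bad (𝓜.p σ) 𝓜.E g) ≤
      √((𝓜.kappa + 𝓜.rho + 𝓜.kappa ^ 2) * (𝓜.badProb + 𝓜.rho)) := by
    rw [𝓜.avg_congr (k := fun _ S => (numIn 𝓜.E S : ℝ) * if Spaced 𝓜.Bad 𝓜.E S then 0 else 1)
      fun σ => sum_wt_completions_sub (𝓜.p_ne_one σ) 𝓜.nonempty 𝓜.Bad]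
    refine Real.le_sqrt_of_sq_le ((𝓜.avg_mul_sq_le _ _).trans ?_)
    have h3 : ∀ S, (if Spaced 𝓜.Bad 𝓜.E S then (0 : ℝ) else 1) ^ 2 =
        if Spaced 𝓜.Bad 𝓜.E S then (0 : ℝ) else 1 := fun S => by split_ifs <;> norm_num
    simp only [h3]
    refine mul_le_mul 𝓜.avg_numIn_sq_le 𝓜.avg_not_spaced_le
      (𝓜.avg_nonneg fun _ _ => by split_ifs <;> norm_num) ?_
    have := 𝓜.kappa_nonneg
    have := 𝓜.rho_nonneg
    positivity
  rw [fluct]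
  refine le_trans ?_ (add_le_add h2 h1)
  rw [← avg_add]
  refine 𝓜.avg_mono fun σ g => ?_
  have h3 := spacedCompletions_le (𝓜.p_nonneg σ) (𝓜.p_lt_one σ) 𝓜.E 𝓜.Bad g
  have h4 := abs_sub_comm (completions (𝓜.p σ) 𝓜.E g) (spacedCompletions 𝓜.Bad (𝓜.p σ) 𝓜.E g)
  have h5 := abs_sub_le (spacedCompletions 𝓜.Bad (𝓜.p σ) 𝓜.E g) (completions (𝓜.p σ) 𝓜.E g) 𝓜.mu
  rw [← h4, abs_of_nonneg (sub_nonneg.2 h3)] at h5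
  exact h5

/-- The expectation of `r` on the spaced configurations with exactly `m` targets. -/
def level (r : Finset ι → ℝ) (m : ℕ) : ℝ :=
  𝓜.avg fun _ S => if Spaced 𝓜.Bad 𝓜.E S ∧ numIn 𝓜.E S = m then r S else 0

variable {r : Finset ι → ℝ}

/-- The exact recursion has the random completion weight in place of `mu`; as `r` is bounded by `1`,
the replacement costs at most the mean deviation of that weight. -/
lemma abs_level_succ_sub_le (hr1 : ∀ S, |r S| ≤ 1)
    (hr : ∀ S C, Spaced 𝓜.Bad 𝓜.E S → 𝓜.E C ⊆ S →
      r S = (∑ e ∈ 𝓜.E C, r (S.erase e)) / (𝓜.E C).card) (m : ℕ) :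
    |(m + 1) * 𝓜.level r (m + 1) - 𝓜.mu * 𝓜.level r m| ≤ 𝓜.fluct := by
  have h1 : (m + 1) * 𝓜.level r (m + 1) = 𝓜.avg fun σ g =>
      (if Spaced 𝓜.Bad 𝓜.E g ∧ numIn 𝓜.E g = m then r g else 0) *
        spacedCompletions 𝓜.Bad (𝓜.p σ) 𝓜.E g := by
    rw [level, avg, avg, Finset.mul_sum]
    refine Finset.sum_congr rfl fun σ _ => ?_
    rw [mul_left_comm, sum_wt_level_succ (𝓜.p_ne_one σ) 𝓜.mono hr m]
  rw [h1, level, ← avg_const_mul, ← avg_sub]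
  refine (𝓜.abs_avg_le _).trans (le_trans (𝓜.avg_mono fun σ g => ?_)
    𝓜.avg_abs_spacedCompletions_sub_le)
  rw [mul_comm 𝓜.mu, ← mul_sub, abs_mul]
  refine mul_le_of_le_one_left (abs_nonneg _) ?_
  split_ifs
  · exact hr1 g
  · simp

lemma abs_level_sub_le (hr1 : ∀ S, |r S| ≤ 1)
    (hr : ∀ S C, Spaced 𝓜.Bad 𝓜.E S → 𝓜.E C ⊆ S →
      r S = (∑ e ∈ 𝓜.E C, r (S.erase e)) / (𝓜.E C).card) (m : ℕ) :
    |𝓜.level r m - 𝓜.mu ^ m / m.factorial * 𝓜.level r 0| ≤ 𝓜.fluct * (1 + 𝓜.mu) ^ m := by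
  induction m with
  | zero => simpa using 𝓜.fluct_nonneg
  | succ m ih =>
    have h := 𝓜.abs_level_succ_sub_le hr1 hr m
    have hmu := 𝓜.mu_nonneg
    have hf := 𝓜.fluct_nonneg
    have hm : (0 : ℝ) < m + 1 := by positivity
    have e1 : 𝓜.level r (m + 1) - 𝓜.mu ^ (m + 1) / (m + 1).factorial * 𝓜.level r 0 =
        (((m + 1) * 𝓜.level r (m + 1) - 𝓜.mu * 𝓜.level r m) +
          𝓜.mu * (𝓜.level r m - 𝓜.mu ^ m / m.factorial * 𝓜.level r 0)) / (m + 1) := by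
      rw [Nat.factorial_succ]
      push_cast
      field_simp
      ring
    rw [e1, abs_div, abs_of_pos hm, div_le_iff₀ hm]
    have h1 : (1 : ℝ) ≤ (1 + 𝓜.mu) ^ m := one_le_pow₀ (by linarith)
    calc _ ≤ 𝓜.fluct + 𝓜.mu * (𝓜.fluct * (1 + 𝓜.mu) ^ m) := by
          refine (abs_add_le _ _).trans (add_le_add h ?_)
          rw [abs_mul, abs_of_nonneg hmu]
          exact mul_le_mul_of_nonneg_left ih hmu
      -- The new error is absorbed because `1 ≤ (1 + mu) ^ m`; the gain from dividing by `m + 1` is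
      -- then discarded.
      _ ≤ 𝓜.fluct * (1 + 𝓜.mu) ^ (m + 1) * 1 := by
          rw [pow_succ]
          nlinarith [mul_le_mul_of_nonneg_left h1 hf]
      _ ≤ _ := by
          gcongr
          linarith [Nat.cast_nonneg (α := ℝ) m]

lemma abs_avg_sub_sum_level_le (hr1 : ∀ S, |r S| ≤ 1) (M : ℕ) :
    |𝓜.avg (fun _ S => r S) - ∑ m ∈ Finset.range (M + 1), 𝓜.level r m| ≤
      𝓜.badProb + 𝓜.rho + 𝓜.kappa / (M + 1) := by
  have hM : (0 : ℝ) < M + 1 := by positivity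
  have h1 : 𝓜.avg (fun _ S => (numIn 𝓜.E S : ℝ) / (M + 1)) ≤ 𝓜.kappa / (M + 1) := by
    have : 𝓜.avg (fun _ S => (numIn 𝓜.E S : ℝ) / (M + 1)) = (1 / (M + 1)) * 𝓜.mu := by
      rw [mu, ← avg_const_mul]; congr; funext _ S; ring
    rw [this, one_div, ← div_eq_inv_mul]
    gcongr
    exact 𝓜.mu_le_kappa
  refine le_trans ?_ (add_le_add 𝓜.avg_not_spaced_le h1)
  simp only [level]
  rw [← avg_sum, ← avg_sub, ← avg_add]
  refine (𝓜.abs_avg_le _).trans (𝓜.avg_mono fun _ S => ?_)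
  have hnn : (0 : ℝ) ≤ (numIn 𝓜.E S : ℝ) / (M + 1) := by positivity
  by_cases hS : Spaced 𝓜.Bad 𝓜.E S
  · simp only [hS, true_and, Finset.sum_ite_eq, Finset.mem_range, if_true, zero_add]
    split_ifs with hm
    · simpa using hnn
    · rw [sub_zero]
      refine (hr1 S).trans ?_
      rw [le_div_iff₀ hM, one_mul]
      exact_mod_cast not_lt.1 hm
  · simp only [hS, false_and, if_false, Finset.sum_const_zero, sub_zero]
    linarith [hr1 S]

/-- The total error in the comparison of the modified with the conditioned model. -/
def totalError (M : ℕ) : ℝ :=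
  𝓜.badProb + 𝓜.rho + 𝓜.kappa / (M + 1) + (M + 1) * (𝓜.fluct * (1 + 𝓜.kappa) ^ M)

/-- The expectation of `r` is, up to a small error, a universal multiple of its expectation on
the configurations that are neither bad nor contain a target. -/
theorem abs_avg_sub_mul_level_zero_le (hr1 : ∀ S, |r S| ≤ 1)
    (hr : ∀ S C, Spaced 𝓜.Bad 𝓜.E S → 𝓜.E C ⊆ S →
      r S = (∑ e ∈ 𝓜.E C, r (S.erase e)) / (𝓜.E C).card) (M : ℕ) :
    |𝓜.avg (fun _ S => r S) -
      (∑ m ∈ Finset.range (M + 1), 𝓜.mu ^ m / m.factorial) * 𝓜.level r 0| ≤ 𝓜.totalError M := by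
  have h1 := 𝓜.abs_avg_sub_sum_level_le hr1 M
  have h2 : |∑ m ∈ Finset.range (M + 1), 𝓜.level r m -
      (∑ m ∈ Finset.range (M + 1), 𝓜.mu ^ m / m.factorial) * 𝓜.level r 0| ≤
      (M + 1) * (𝓜.fluct * (1 + 𝓜.kappa) ^ M) := by
    rw [Finset.sum_mul, ← Finset.sum_sub_distrib]
    refine (Finset.abs_sum_le_sum_abs _ _).trans ?_
    calc _ ≤ ∑ m ∈ Finset.range (M + 1), 𝓜.fluct * (1 + 𝓜.kappa) ^ M := by
          refine Finset.sum_le_sum fun m hm => (𝓜.abs_level_sub_le hr1 hr m).trans ?_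
          have hmu := 𝓜.mu_nonneg
          have hk := 𝓜.mu_le_kappa
          refine mul_le_mul_of_nonneg_left ?_ 𝓜.fluct_nonneg
          calc _ ≤ (1 + 𝓜.kappa) ^ m := by gcongr
            _ ≤ _ := pow_le_pow_right₀ (by linarith) (Nat.lt_succ_iff.1 (Finset.mem_range.1 hm))
      _ = _ := by simp
  exact (abs_sub_le _ _ _).trans (add_le_add h1 h2)

end TargetModel

/-! ### Short cycles: edge counts and overlaps. -/

section Graphs

variable {n N : ℕ}

/-- The edges of a subgraph as a finite set of pairs. -/
def edgePairs (H : KSubgraph n) : Finset (Pairs n) := Finset.univ.filter fun e => e.1 ∈ H.edgeSet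

lemma mem_edgePairs {H : KSubgraph n} {e : Pairs n} : e ∈ edgePairs H ↔ e.1 ∈ H.edgeSet := by
  simp [edgePairs]

lemma not_isDiag_of_mem_edgeSet {H : KSubgraph n} {e : Sym2 (Fin n)} (he : e ∈ H.edgeSet) :
    ¬ e.IsDiag :=
  (⊤ : SimpleGraph (Fin n)).not_isDiag_of_mem_edgeSet (H.edgeSet_subset he)

lemma image_edgePairs (H : KSubgraph n) :
    (Subtype.val '' (edgePairs H : Set (Pairs n)) : Set (Sym2 (Fin n))) = H.edgeSet := by
  ext e
  simp only [Set.mem_image, Finset.mem_coe, mem_edgePairs]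
  exact ⟨fun ⟨a, ha, h⟩ => h ▸ ha, fun he => ⟨⟨e, not_isDiag_of_mem_edgeSet he⟩, he, rfl⟩⟩

lemma card_edgePairs (H : KSubgraph n) : (edgePairs H).card = H.edgeSet.ncard := by
  rw [← image_edgePairs, Set.ncard_image_of_injective _ Subtype.val_injective,
    Set.ncard_coe_finset]

lemma edgePairs_sup (H H' : KSubgraph n) : edgePairs (H ⊔ H') = edgePairs H ∪ edgePairs H' := by
  ext e; simp [mem_edgePairs]

lemma sum_ncard_neighborSet (H : KSubgraph n) :
    ∑ v, (H.neighborSet v).ncard = 2 * H.edgeSet.ncard := by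
  have h := H.spanningCoe.sum_degrees_eq_twice_card_edges
  have h1 : ∀ v, H.spanningCoe.degree v = (H.neighborSet v).ncard := by
    intro v
    rw [← SimpleGraph.card_neighborSet_eq_degree, Fintype.card_eq_nat_card]
    rfl
  have h2 : H.spanningCoe.edgeFinset.card = H.edgeSet.ncard := by
    rw [← Set.ncard_coe_finset, SimpleGraph.coe_edgeFinset, SimpleGraph.Subgraph.edgeSet_spanningCoe]
  rw [← h2, ← h]
  simp [h1]

lemma ncard_neighborSet_of_notMem {H : KSubgraph n} {v : Fin n} (hv : v ∉ H.verts) :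
    (H.neighborSet v).ncard = 0 := by
  rw [Set.ncard_eq_zero]
  ext w
  simp only [SimpleGraph.Subgraph.mem_neighborSet, Set.mem_empty_iff_false, iff_false]
  exact fun h => hv h.fst_mem

lemma IsShortCycle.connected {H : KSubgraph n} (h : IsShortCycle n N H) : H.Connected := by
  obtain ⟨u, w, -, -, rfl⟩ := h
  exact w.toSubgraph_connected

lemma IsShortCycle.ncard_neighborSet {H : KSubgraph n} (h : IsShortCycle n N H) {v : Fin n}
    (hv : v ∈ H.verts) : (H.neighborSet v).ncard = 2 := by
  obtain ⟨u, w, hw, -, rfl⟩ := h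
  exact hw.ncard_neighborSet_toSubgraph_eq_two (w.mem_verts_toSubgraph.1 hv)

lemma sum_ite_mem_ncard (s : Set (Fin n)) (c : ℕ) :
    ∑ v, (if v ∈ s then c else 0) = c * s.ncard := by
  rw [← Finset.sum_filter, Finset.sum_const, smul_eq_mul, mul_comm, ← Set.ncard_coe_finset]
  simp

/-- Handshake identity for a graph that is 2-regular on its vertex set. -/
lemma IsShortCycle.ncard_verts {H : KSubgraph n} (h : IsShortCycle n N H) :
    H.verts.ncard = H.edgeSet.ncard := by
  have h1 := sum_ncard_neighborSet H
  have h2 : ∀ v, (H.neighborSet v).ncard = if v ∈ H.verts then 2 else 0 := by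
    intro v
    split_ifs with hv
    · exact h.ncard_neighborSet hv
    · exact ncard_neighborSet_of_notMem hv
  simp only [h2, sum_ite_mem_ncard] at h1
  omega

lemma IsShortCycle.ncard_edgeSet_le {H : KSubgraph n} (h : IsShortCycle n N H) :
    H.edgeSet.ncard ≤ N := by
  obtain ⟨u, w, -, hN, rfl⟩ := h
  refine le_trans ?_ hN
  rw [← w.length_edges]
  have : w.toSubgraph.edgeSet = (w.edges.toFinset : Set (Sym2 (Fin n))) := by
    ext e; simp
  rw [this, Set.ncard_coe_finset]
  exact w.edges.toFinset_card_le

lemma IsShortCycle.edgePairs_nonempty {H : KSubgraph n} (h : IsShortCycle n N H) :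
    (edgePairs H).Nonempty := by
  rw [← Finset.card_pos, card_edgePairs, ← h.ncard_verts]
  exact (Set.ncard_pos (Set.toFinite _)).2 h.connected.nonempty

/-- If every common vertex of a connected subgraph `H` and a subgraph `H'` has the same
neighbours in both, and a common vertex exists, then `H ≤ H'`. -/
lemma le_of_neighborSet_eq {H H' : KSubgraph n} (hH : H.Connected)
    (hne : (H.verts ∩ H'.verts).Nonempty)
    (hnb : ∀ v ∈ H.verts ∩ H'.verts, H.neighborSet v = H'.neighborSet v) : H ≤ H' := by
  obtain ⟨v₀, hv₀, hv₀'⟩ := hne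
  have hall : ∀ v : H.verts, (v : Fin n) ∈ H'.verts := by
    intro v
    obtain ⟨w⟩ := hH.preconnected ⟨v₀, hv₀⟩ v
    have key : ∀ {a b : H.verts} (_ : H.coe.Walk a b), (a : Fin n) ∈ H'.verts →
        (b : Fin n) ∈ H'.verts := by
      intro a b w
      induction w with
      | nil => exact id
      | cons hadj _ ih =>
        intro ha
        apply ih
        have h1 : _ ∈ H.neighborSet _ := hadj
        rw [hnb _ ⟨Subtype.property _, ha⟩] at h1
        exact SimpleGraph.Subgraph.Adj.snd_mem h1
    exact key w hv₀'
  refine ⟨fun v hv => hall ⟨v, hv⟩, fun a b hab => ?_⟩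
  have h1 : b ∈ H.neighborSet a := hab
  rw [hnb a ⟨hab.fst_mem, hall ⟨a, hab.fst_mem⟩⟩] at h1
  exact h1

/-- Two different cycles with a common vertex have more edges than vertices together. -/
lemma IsShortCycle.ncard_union_lt {H H' : KSubgraph n} (h : IsShortCycle n N H)
    (h' : IsShortCycle n N H') (hne : H ≠ H') (hv : (H.verts ∩ H'.verts).Nonempty) :
    (H ⊔ H').verts.ncard < (H ⊔ H').edgeSet.ncard := by
  have hdeg : ∀ v ∈ (H ⊔ H').verts, 2 ≤ ((H ⊔ H').neighborSet v).ncard := by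
    rintro v (hv | hv)
    · rw [← h.ncard_neighborSet hv, SimpleGraph.Subgraph.neighborSet_sup]
      exact Set.ncard_le_ncard Set.subset_union_left
    · rw [← h'.ncard_neighborSet hv, SimpleGraph.Subgraph.neighborSet_sup]
      exact Set.ncard_le_ncard Set.subset_union_right
  -- If no degree in the union exceeded `2`, the cycles would have the same neighbours at each
  -- common vertex and, being connected, would coincide. One degree above `2` makes the handshake
  -- inequality strict.
  have hstrict : ∃ v ∈ (H ⊔ H').verts, 2 < ((H ⊔ H').neighborSet v).ncard := by
    by_contra! hcon
    have hnb : ∀ v ∈ H.verts ∩ H'.verts, H.neighborSet v = H'.neighborSet v := by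
      rintro v ⟨h1, h2⟩
      have h3 := hcon v (Or.inl h1)
      rw [SimpleGraph.Subgraph.neighborSet_sup] at h3
      have e1 : H.neighborSet v = H.neighborSet v ∪ H'.neighborSet v :=
        Set.eq_of_subset_of_ncard_le Set.subset_union_left (by rwa [h.ncard_neighborSet h1])
      have e2 : H'.neighborSet v = H.neighborSet v ∪ H'.neighborSet v :=
        Set.eq_of_subset_of_ncard_le Set.subset_union_right (by rwa [h'.ncard_neighborSet h2])
      rw [e1, ← e2]
    refine hne (le_antisymm (le_of_neighborSet_eq h.connected hv hnb)
      (le_of_neighborSet_eq h'.connected (by rwa [Set.inter_comm]) fun v hv => ?_))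
    exact (hnb v hv.symm).symm
  have hlt : ∑ v, (if v ∈ (H ⊔ H').verts then 2 else 0) <
      ∑ v, ((H ⊔ H').neighborSet v).ncard := by
    obtain ⟨v, hv1, hv2⟩ := hstrict
    refine Finset.sum_lt_sum (fun v _ => ?_) ⟨v, Finset.mem_univ v, by rwa [if_pos hv1]⟩
    split_ifs with hv
    · exact hdeg v hv
    · exact Nat.zero_le _
  rw [sum_ncard_neighborSet, sum_ite_mem_ncard] at hlt
  omega

end Graphs

/-! ### Weighted counts of short cycles and of overlapping pairs. -/

section Counting

variable {n N : ℕ}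

instance (n : ℕ) : Fintype (KSubgraph n) := Fintype.ofFinite _

lemma edgeSet_subset_sym2 {H : KSubgraph n} {W : Finset (Fin n)} (hW : H.verts ⊆ W) :
    H.edgeSet ⊆ (W.sym2 : Set (Sym2 (Fin n))) := by
  intro e he
  rw [Finset.mem_coe, Finset.mem_sym2_iff]
  intro v hv
  exact hW (SimpleGraph.Subgraph.mem_verts_of_mem_edge he hv)

lemma subgraph_ext_of_toFinset_eq {H H' : KSubgraph n}
    (hv : H.verts.toFinset = H'.verts.toFinset)
    (he : H.edgeSet.toFinset = H'.edgeSet.toFinset) : H = H' := by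
  rw [Set.toFinset_inj] at hv he
  refine SimpleGraph.Subgraph.ext hv ?_
  funext a b
  rw [← SimpleGraph.Subgraph.mem_edgeSet, ← SimpleGraph.Subgraph.mem_edgeSet, he]

/-- A bound for the number of graphs on at most `m` given vertices. -/
def graphCount (m : ℕ) : ℕ := 2 ^ m * 2 ^ (m + 1).choose 2

lemma card_subgraph_le {m : ℕ} {W : Finset (Fin n)} (hW : W.card ≤ m) :
    (Finset.univ.filter fun H : KSubgraph n => H.verts.toFinset ⊆ W).card ≤ graphCount m := by
  calc _ ≤ (W.powerset ×ˢ W.sym2.powerset).card := by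
        refine Finset.card_le_card_of_injOn
          (fun H => (H.verts.toFinset, H.edgeSet.toFinset)) (fun H hH => ?_) ?_
        · have hH' : H.verts.toFinset ⊆ W := by simpa using hH
          have h2 : H.edgeSet ⊆ (W.sym2 : Set (Sym2 (Fin n))) :=
            edgeSet_subset_sym2 fun v hv => hH' (Set.mem_toFinset.2 hv)
          simp only [Finset.coe_product, Set.mem_prod, Finset.mem_coe, Finset.mem_powerset]
          exact ⟨hH', fun e he => h2 (Set.mem_toFinset.1 he)⟩
        · intro H _ H' _ h
          rw [Prod.mk.injEq] at h
          exact subgraph_ext_of_toFinset_eq h.1 h.2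
    _ ≤ graphCount m := by
        rw [Finset.card_product, Finset.card_powerset, Finset.card_powerset, Finset.card_sym2,
          graphCount]
        exact Nat.mul_le_mul (Nat.pow_le_pow_right two_pos hW)
          (Nat.pow_le_pow_right two_pos (Nat.choose_le_choose 2 (Nat.succ_le_succ hW)))

/-- There are at most `n ^ v` sets of size `v`, which cancels `n ^ v` in the weight; each of the `m
+ 1` sizes then contributes at most `K ^ m`. -/
lemma sum_pow_card_le {K : ℝ} (hK : 1 ≤ K) (hn : 0 < n) (m : ℕ) :
    ∑ W : Finset (Fin n), (if W.card ≤ m then (K / n) ^ W.card else 0) ≤ (m + 1) * K ^ m := by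
  have hn' : (0 : ℝ) < n := by exact_mod_cast hn
  have h := Finset.sum_powerset_apply_card (fun v => if v ≤ m then (K / n) ^ v else 0)
    (x := (Finset.univ : Finset (Fin n)))
  rw [Finset.powerset_univ] at h
  rw [h]
  calc _ ≤ ∑ v ∈ Finset.range ((Finset.univ : Finset (Fin n)).card + 1),
        (if v ∈ Finset.range (m + 1) then K ^ m else 0) := by
        refine Finset.sum_le_sum fun v _ => ?_
        simp only [Finset.card_univ, Fintype.card_fin, Finset.mem_range, Nat.lt_succ_iff]
        split_ifs with hv
        · rw [nsmul_eq_mul, div_pow]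
          have h1 : ((n.choose v : ℕ) : ℝ) ≤ (n : ℝ) ^ v := by
            exact_mod_cast Nat.choose_le_pow n v
          calc _ ≤ (n : ℝ) ^ v * (K ^ v / n ^ v) := by gcongr
            _ = K ^ v := by field_simp
            _ ≤ K ^ m := pow_le_pow_right₀ hK hv
        · simp
    _ ≤ ∑ v ∈ Finset.range (m + 1), K ^ m := by
        rw [← Finset.sum_filter]
        refine Finset.sum_le_sum_of_subset_of_nonneg (fun v hv => (Finset.mem_filter.1 hv).2) ?_
        intros; positivity
    _ = _ := by simp

/-- Sums over objects supported on few vertices. -/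
lemma sum_le_of_support {α : Type*} [Fintype α] {φ : α → Finset (Fin n)} {m c : ℕ} {K : ℝ}
    (hK : 1 ≤ K) (hn : 0 < n) (hφ : ∀ a, (φ a).card ≤ m)
    (hc : ∀ W : Finset (Fin n), W.card ≤ m → (Finset.univ.filter fun a => φ a = W).card ≤ c) :
    ∑ a, (K / n) ^ (φ a).card ≤ c * ((m + 1) * K ^ m) := by
  calc _ = ∑ W : Finset (Fin n), ∑ a ∈ Finset.univ.filter (fun a => φ a = W),
        (K / n) ^ (φ a).card := (Finset.sum_fiberwise _ _ _).symm
    _ ≤ ∑ W : Finset (Fin n), c * (if W.card ≤ m then (K / n) ^ W.card else 0) := by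
        refine Finset.sum_le_sum fun W _ => ?_
        by_cases hW : W.card ≤ m
        · rw [if_pos hW, Finset.sum_congr rfl fun a ha => by rw [(Finset.mem_filter.1 ha).2],
            Finset.sum_const, nsmul_eq_mul]
          have := hc W hW
          gcongr
        · rw [if_neg hW, mul_zero, Finset.sum_eq_zero]
          intro a ha
          exact absurd ((Finset.mem_filter.1 ha).2 ▸ hφ a) hW
    _ ≤ _ := by
        rw [← Finset.mul_sum]
        exact mul_le_mul_of_nonneg_left (sum_pow_card_le hK hn m) (Nat.cast_nonneg c)

/-- The cycles of length at most `N`. -/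
abbrev ShortCycle (n N : ℕ) : Type := {H : KSubgraph n // IsShortCycle n N H}

instance (n N : ℕ) : Fintype (ShortCycle n N) := Fintype.ofFinite _

lemma card_shortCycle_le {m : ℕ} {W : Finset (Fin n)} (hW : W.card ≤ m) :
    (Finset.univ.filter fun C : ShortCycle n N => C.1.verts.toFinset ⊆ W).card ≤ graphCount m := by
  refine le_trans (Finset.card_le_card_of_injOn Subtype.val (fun C hC => ?_)
    Subtype.val_injective.injOn) (card_subgraph_le hW)
  simpa using hC

lemma ShortCycle.card_toFinset (C : ShortCycle n N) :
    C.1.verts.toFinset.card = (edgePairs C.1).card := by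
  rw [card_edgePairs, ← C.2.ncard_verts, Set.ncard_eq_toFinset_card']

lemma ShortCycle.card_toFinset_le (C : ShortCycle n N) : C.1.verts.toFinset.card ≤ N := by
  rw [C.card_toFinset, card_edgePairs]
  exact C.2.ncard_edgeSet_le

lemma sum_shortCycle_le {K : ℝ} (hK : 1 ≤ K) (hn : 0 < n) :
    ∑ C : ShortCycle n N, (K / n) ^ (edgePairs C.1).card ≤
      graphCount N * ((N + 1) * K ^ N) := by
  simp only [← ShortCycle.card_toFinset]
  refine sum_le_of_support (φ := fun C : ShortCycle n N => C.1.verts.toFinset) hK hn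
    (fun C => C.card_toFinset_le) fun W hW => ?_
  refine le_trans (Finset.card_le_card fun C hC => ?_) (card_shortCycle_le hW)
  simp only [Finset.mem_filter, Finset.mem_univ, true_and] at hC ⊢
  exact hC.le

/-- The union of two distinct touching cycles has an excess edge. Trading edges for vertices leaves
one spare factor `K / n` times a bounded count of pairs supported on at most `2 * N` vertices. -/
lemma sum_near_shortCycle_le {K : ℝ} (hK : 1 ≤ K) (hn : K ≤ n) :
    ∑ C : ShortCycle n N, ∑ C' : ShortCycle n N,
      (if (C.1.verts ∩ C'.1.verts).Nonempty ∧ C ≠ C' then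
        (K / n) ^ (edgePairs C.1 ∪ edgePairs C'.1).card else 0) ≤
      K / n * ((graphCount (2 * N) ^ 2 : ℕ) * ((2 * N + 1) * K ^ (2 * N))) := by
  have hn0 : (0 : ℝ) < n := by linarith
  have hx0 : 0 ≤ K / n := by positivity
  have hx1 : K / n ≤ 1 := (div_le_one hn0).2 hn
  have h1 := sum_le_of_support
    (φ := fun z : ShortCycle n N × ShortCycle n N => z.1.1.verts.toFinset ∪ z.2.1.verts.toFinset)
    (m := 2 * N) (c := graphCount (2 * N) ^ 2) hK (by exact_mod_cast hn0) (fun z => ?_)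
    fun W hW => ?_
  · push_cast at h1 ⊢
    refine le_trans ?_ (mul_le_mul_of_nonneg_left h1 hx0)
    rw [← Fintype.sum_prod_type' (f := fun C C' : ShortCycle n N =>
      (if (C.1.verts ∩ C'.1.verts).Nonempty ∧ C ≠ C' then
        (K / n) ^ (edgePairs C.1 ∪ edgePairs C'.1).card else 0)), Finset.mul_sum]
    refine Finset.sum_le_sum fun z _ => ?_
    split_ifs with hz
    · rw [← pow_succ']
      refine pow_le_pow_of_le_one hx0 hx1 ?_
      have h2 := z.1.2.ncard_union_lt z.2.2 (fun h => hz.2 (Subtype.ext h)) hz.1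
      rw [← card_edgePairs, edgePairs_sup, SimpleGraph.Subgraph.verts_sup,
        Set.ncard_eq_toFinset_card', Set.toFinset_union] at h2
      exact h2
    · positivity
  · have h2 := z.1.card_toFinset_le
    have h3 := z.2.card_toFinset_le
    exact (Finset.card_union_le _ _).trans (by omega)
  · have h2 := card_shortCycle_le (N := N) hW
    rw [sq]
    refine le_trans ?_ (Nat.mul_le_mul h2 h2)
    rw [← Finset.card_product]
    refine Finset.card_le_card fun z hz => ?_
    simp only [Finset.mem_filter, Finset.mem_univ, true_and, Finset.mem_product] at hz ⊢
    rw [← hz]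
    exact ⟨Finset.subset_union_left, Finset.subset_union_right⟩

end Counting

/-! ### First moment of small bad graphs. -/

section Bad

variable {n k : ℕ} {lam D : ℝ} {H : KSubgraph n}

/-- In `Phi` the vertex base is at least `1`, and so is the product of the vertex and edge bases,
since `n` and `D ^ 50` cancel. With at most as many edges as vertices, `Phi` would be at least `1`.
-/
lemma IsBad.ncard_verts_lt (hk : 1 ≤ k) (hD : 0 < D) (hn : D ^ 50 ≤ n) (hlog : 1 ≤ Real.log n)
    (h : IsBad n k lam D H) : H.verts.ncard < H.edgeSet.ncard := by
  by_contra! hle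
  have hk' : (1 : ℝ) ≤ k := by exact_mod_cast hk
  have ha : 1 ≤ max lam 1 := le_max_right _ _
  have hDp : 0 < D ^ 50 := by positivity
  have hn0 : (0 : ℝ) < n := hDp.trans_le hn
  obtain ⟨d, hd⟩ := Nat.exists_eq_add_of_le hle
  have h1 : 1 ≤ 2 * (max lam 1) ^ 2 * (k : ℝ) ^ 2 * n / D ^ 50 := by
    rw [one_le_div hDp]
    have h3 : 1 ≤ (max lam 1) ^ 2 * (k : ℝ) ^ 2 :=
      one_le_mul_of_one_le_of_one_le (one_le_pow₀ ha) (one_le_pow₀ hk')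
    nlinarith
  have h2 : 1 ≤ (2 * (max lam 1) ^ 2 * (k : ℝ) ^ 2 * n / D ^ 50) *
      (1000 * (max lam 1) ^ 20 * (k : ℝ) ^ 20 * D ^ 50 / n) := by
    have : (2 * (max lam 1) ^ 2 * (k : ℝ) ^ 2 * n / D ^ 50) *
      (1000 * (max lam 1) ^ 20 * (k : ℝ) ^ 20 * D ^ 50 / n) =
      2000 * ((max lam 1) ^ 22 * (k : ℝ) ^ 22) := by
      field_simp; norm_num
    rw [this]
    have h3 : 1 ≤ (max lam 1) ^ 22 * (k : ℝ) ^ 22 :=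
      one_le_mul_of_one_le_of_one_le (one_le_pow₀ ha) (one_le_pow₀ hk')
    linarith
  have h4 : 1 ≤ Phi n k lam D H := by
    rw [Phi, hd, pow_add, mul_right_comm, ← mul_pow]
    exact one_le_mul_of_one_le_of_one_le (one_le_pow₀ h2) (one_le_pow₀ h1)
  have h5 : (Real.log n)⁻¹ ≤ 1 := inv_le_one_of_one_le₀ hlog
  exact absurd h (not_lt.2 (h5.trans h4))

/-- The contribution of a vertex set and an edge set of the given sizes to the first moment of the
number of bad graphs. -/
def badTerm (n v e : ℕ) : ℝ :=
  if v < e then (1 / (2 * n)) ^ v * (1 / 1000) ^ e * ((v : ℝ) ^ v / v ^ e) else 0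

/-- The presence probability is compared with `Phi`, badness supplies `(log n)⁻¹`, and the remaining
factor no longer depends on `D` and is summable over all subgraphs. -/
lemma IsBad.pow_le (hk : 1 ≤ k) (hD : 1 ≤ D) (hn : D ^ 50 ≤ n) (hlog : 1 ≤ Real.log n)
    (h : IsBad n k lam D H) (hs : IsSmall n D H) :
    (k * max lam 1 / n) ^ H.edgeSet.ncard ≤
      (Real.log n)⁻¹ * badTerm n H.verts.ncard H.edgeSet.ncard := by
  have hlt := h.ncard_verts_lt hk (by linarith) hn hlog
  have hk' : (1 : ℝ) ≤ k := by exact_mod_cast hk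
  have ha : 1 ≤ max lam 1 := le_max_right _ _
  have hDp : 1 ≤ D ^ 50 := one_le_pow₀ hD
  have hn0 : (0 : ℝ) < n := by linarith
  have hv0 : 0 < H.verts.ncard := by
    by_contra! h0
    have h1 : H.verts = ∅ := (Set.ncard_eq_zero).1 (Nat.le_zero.1 h0)
    have h2 : H.edgeSet = ∅ := by
      have := edgeSet_subset_sym2 (H := H) (W := ∅) (by simp [h1])
      simpa using this
    simp [h2] at hlt
  rw [badTerm, if_pos hlt]
  set v := H.verts.ncard
  set e := H.edgeSet.ncard
  have hv0' : (0 : ℝ) < v := by exact_mod_cast hv0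
  have hvD : (v : ℝ) ≤ D ^ 50 := hs.trans (pow_le_pow_right₀ hD (by norm_num))
  -- Smallness enters here: `v ≤ D ^ 3 ≤ D ^ 50` and `v < e`, so the negative power of `D ^ 50` may
  -- be replaced by the same power of `v`.
  have hratio : (D ^ 50) ^ v / (D ^ 50) ^ e ≤ (v : ℝ) ^ v / v ^ e := by
    obtain ⟨d, hd⟩ := Nat.exists_eq_add_of_lt hlt
    have hd' : e = v + (d + 1) := by omega
    have : (v : ℝ) ^ (d + 1) ≤ (D ^ 50) ^ (d + 1) := by gcongr
    rw [hd', pow_add _ v, pow_add _ v, div_mul_cancel_left₀ (by positivity),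
      div_mul_cancel_left₀ (by positivity)]
    gcongr
  have h1 : (k * max lam 1 / n) ^ e ≤ Phi n k lam D H *
      ((1 / (2 * n)) ^ v * (1 / 1000) ^ e * ((D ^ 50) ^ v / (D ^ 50) ^ e)) := by
    have e1 : Phi n k lam D H *
      ((1 / (2 * n)) ^ v * (1 / 1000) ^ e * ((D ^ 50) ^ v / (D ^ 50) ^ e)) =
      ((max lam 1) ^ 2 * (k : ℝ) ^ 2) ^ v * ((k * max lam 1) ^ 20 / n) ^ e := by
      have e2 : (max lam 1) ^ 2 * (k : ℝ) ^ 2 =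
          (2 * (max lam 1) ^ 2 * (k : ℝ) ^ 2 * n / D ^ 50) * (1 / (2 * n) * D ^ 50) := by
        field_simp
      have e3 : (k * max lam 1) ^ 20 / n =
          (1000 * (max lam 1) ^ 20 * (k : ℝ) ^ 20 * D ^ 50 / n) * (1 / 1000 * (1 / D ^ 50)) := by
        field_simp
      rw [e2, e3, Phi]
      simp only [mul_pow, one_div, inv_pow]
      ring
    rw [e1]
    have h2 : 1 ≤ ((max lam 1) ^ 2 * (k : ℝ) ^ 2) ^ v :=
      one_le_pow₀ (one_le_mul_of_one_le_of_one_le (one_le_pow₀ ha) (one_le_pow₀ hk'))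
    have h3 : k * max lam 1 ≤ (k * max lam 1) ^ 20 :=
      le_self_pow₀ (one_le_mul_of_one_le_of_one_le hk' ha) (by norm_num)
    calc _ ≤ 1 * ((k * max lam 1) ^ 20 / n) ^ e := by rw [one_mul]; gcongr
      _ ≤ _ := by gcongr
  refine h1.trans ?_
  have h' : Phi n k lam D H ≤ (Real.log n)⁻¹ := le_of_lt h
  gcongr

/-- The powers of `n` cancel, leaving `v ^ v / v!` and `v ^ e / e!`, each at most `exp v ≤ 3 ^ v`.
Writing `1 / 1000 = 1 / 10 * 1 / 100` and using `v < e` on the first factor gives the base `1 / 2 *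
1 / 10 * 9 = 9 / 20`. -/
lemma choose_mul_badTerm_le (hn : 0 < n) (v e : ℕ) :
    (n.choose v : ℝ) * (((v + 1).choose 2).choose e * badTerm n v e) ≤
      (9 / 20) ^ v * (1 / 100) ^ e := by
  rw [badTerm]
  split_ifs with hlt
  swap
  · simp only [mul_zero]; positivity
  have hn' : (0 : ℝ) < n := by exact_mod_cast hn
  rcases Nat.eq_zero_or_pos v with rfl | hv
  · have : (0 : ℕ).choose e = 0 := Nat.choose_eq_zero_of_lt hlt
    simp [this]
  have hv' : (0 : ℝ) < v := by exact_mod_cast hv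
  have h1 : (n.choose v : ℝ) ≤ (n : ℝ) ^ v / v.factorial := Nat.choose_le_pow_div v n
  have h2 : ((((v + 1).choose 2).choose e : ℕ) : ℝ) ≤ ((v : ℝ) ^ 2) ^ e / e.factorial := by
    refine (Nat.choose_le_pow_div e _).trans ?_
    have : (v + 1).choose 2 ≤ v ^ 2 := by
      rw [Nat.choose_two_right, Nat.add_sub_cancel]
      refine Nat.div_le_of_le_mul ?_
      nlinarith
    have : (((v + 1).choose 2 : ℕ) : ℝ) ≤ (v : ℝ) ^ 2 := by exact_mod_cast this
    gcongr
  have hexp : Real.exp v ≤ 3 ^ v := by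
    have : Real.exp v = Real.exp 1 ^ v := by rw [← Real.exp_nat_mul, mul_one]
    rw [this]
    have := Real.exp_one_lt_d9
    gcongr
    linarith
  have h3 : (v : ℝ) ^ v / v.factorial ≤ 3 ^ v :=
    (Real.pow_div_factorial_le_exp _ hv'.le v).trans hexp
  have h4 : (v : ℝ) ^ e / e.factorial ≤ 3 ^ v :=
    (Real.pow_div_factorial_le_exp _ hv'.le e).trans hexp
  have h5 : (1 / 10 : ℝ) ^ e ≤ (1 / 10) ^ v :=
    pow_le_pow_of_le_one (by norm_num) (by norm_num) hlt.le
  calc _ ≤ (n : ℝ) ^ v / v.factorial * (((v : ℝ) ^ 2) ^ e / e.factorial *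
        ((1 / (2 * n)) ^ v * (1 / 1000) ^ e * ((v : ℝ) ^ v / v ^ e))) := by gcongr
    _ = (1 / 2) ^ v * ((1 / 10) ^ e * (1 / 100) ^ e) *
        (((v : ℝ) ^ v / v.factorial) * ((v : ℝ) ^ e / e.factorial)) := by
        rw [← mul_pow (1 / 10 : ℝ), ← pow_mul, mul_comm 2 e, pow_mul]
        norm_num
        simp only [mul_pow, inv_pow]
        field_simp
    _ ≤ (1 / 2) ^ v * ((1 / 10) ^ v * (1 / 100) ^ e) * (3 ^ v * 3 ^ v) := by gcongr
    _ = (1 / 2 * (1 / 10) * (3 * 3)) ^ v * (1 / 100) ^ e := by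
        simp only [mul_pow]; ring
    _ = _ := by norm_num

/-- The first moment bound for small bad graphs. -/
lemma sum_bad_le (hk : 1 ≤ k) (hD : 1 ≤ D) (hn : D ^ 50 ≤ n) (hlog : 1 ≤ Real.log n) :
    ∑ H : KSubgraph n, (if IsBad n k lam D H ∧ IsSmall n D H then
      (k * max lam 1 / n) ^ (edgePairs H).card else 0) ≤ 4 * (Real.log n)⁻¹ := by
  have hn0 : (0 : ℝ) < n := by linarith [one_le_pow₀ hD (n := 50)]
  have hn1 : 0 < n := by exact_mod_cast hn0
  have hlog0 : 0 ≤ (Real.log n)⁻¹ := inv_nonneg.2 (by linarith)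
  have ht : ∀ v e, 0 ≤ badTerm n v e := by
    intro v e; rw [badTerm]; split_ifs <;> positivity
  have hgeom : ∀ (q : ℝ) (m : ℕ), 0 ≤ q → q ≤ 1 / 2 → ∑ i ∈ Finset.range m, q ^ i ≤ 2 := by
    intro q m h0 h1
    refine (Summable.sum_le_tsum _ (fun i _ => pow_nonneg h0 i)
      (summable_geometric_of_lt_one h0 (by linarith))).trans ?_
    rw [tsum_geometric_of_lt_one h0 (by linarith)]
    rw [inv_le_comm₀ (by linarith) two_pos]
    linarith
  calc _ ≤ ∑ H : KSubgraph n, (Real.log n)⁻¹ * badTerm n H.verts.ncard H.edgeSet.ncard := by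
        refine Finset.sum_le_sum fun H _ => ?_
        split_ifs with hH
        · rw [card_edgePairs]
          exact hH.1.pow_le hk hD hn hlog hH.2
        · exact mul_nonneg hlog0 (ht _ _)
    _ = (Real.log n)⁻¹ * ∑ H : KSubgraph n,
        badTerm n H.verts.toFinset.card H.edgeSet.toFinset.card := by
        rw [Finset.mul_sum]
        simp only [Set.ncard_eq_toFinset_card']
    _ ≤ (Real.log n)⁻¹ * 4 := by
        refine mul_le_mul_of_nonneg_left ?_ hlog0
        -- Subgraphs are overcounted by pairs of a vertex set `W` and any subset of `W.sym2`. Loops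
        -- are allowed, hence `(v + 1).choose 2` possible edges.
        calc _ ≤ ∑ z ∈ (Finset.univ : Finset (Finset (Fin n))).sigma fun W => W.sym2.powerset,
              badTerm n z.1.card z.2.card := by
              have hinj : Function.Injective (fun H : KSubgraph n =>
                  (⟨H.verts.toFinset, H.edgeSet.toFinset⟩ :
                    (_ : Finset (Fin n)) × Finset (Sym2 (Fin n)))) := by
                intro H H' h
                simp only [Sigma.mk.injEq, heq_eq_eq] at h
                exact subgraph_ext_of_toFinset_eq h.1 h.2
              rw [← Finset.sum_image (f := fun z : (_ : Finset (Fin n)) × Finset (Sym2 (Fin n)) =>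
                badTerm n z.1.card z.2.card) (s := Finset.univ) hinj.injOn]
              refine Finset.sum_le_sum_of_subset_of_nonneg ?_ fun z _ _ => ht _ _
              intro z hz
              obtain ⟨H, -, rfl⟩ := Finset.mem_image.1 hz
              simp only [Finset.mem_sigma, Finset.mem_univ, true_and, Finset.mem_powerset]
              intro e he
              exact Finset.mem_coe.1 (edgeSet_subset_sym2 (H := H) (by simp)
                (Set.mem_toFinset.1 he))
          _ = ∑ W : Finset (Fin n), ∑ F ∈ W.sym2.powerset, badTerm n W.card F.card :=
              Finset.sum_sigma _ _ _
          _ = ∑ v ∈ Finset.range (n + 1), ∑ e ∈ Finset.range ((v + 1).choose 2 + 1),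
              (n.choose v : ℝ) * (((v + 1).choose 2).choose e * badTerm n v e) := by
              have h1 : ∀ W : Finset (Fin n), ∑ F ∈ W.sym2.powerset, badTerm n W.card F.card =
                  ∑ e ∈ Finset.range ((W.card + 1).choose 2 + 1),
                    ((W.card + 1).choose 2).choose e • badTerm n W.card e := by
                intro W
                rw [Finset.sum_powerset_apply_card, Finset.card_sym2]
              simp only [h1]
              rw [← Finset.powerset_univ, Finset.sum_powerset_apply_card (fun v =>
                ∑ e ∈ Finset.range ((v + 1).choose 2 + 1),
                  ((v + 1).choose 2).choose e • badTerm n v e)]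
              simp only [Finset.card_univ, Fintype.card_fin, nsmul_eq_mul, Finset.mul_sum]
          _ ≤ ∑ v ∈ Finset.range (n + 1), ∑ e ∈ Finset.range ((v + 1).choose 2 + 1),
              (9 / 20 : ℝ) ^ v * (1 / 100) ^ e :=
              Finset.sum_le_sum fun v _ => Finset.sum_le_sum fun e _ =>
                choose_mul_badTerm_le hn1 v e
          _ ≤ ∑ v ∈ Finset.range (n + 1), (9 / 20 : ℝ) ^ v * 2 := by
              refine Finset.sum_le_sum fun v _ => ?_
              rw [← Finset.mul_sum]
              exact mul_le_mul_of_nonneg_left (hgeom _ _ (by norm_num) (by norm_num))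
                (by positivity)
          _ ≤ 2 * 2 := by
              rw [← Finset.sum_mul]
              exact mul_le_mul_of_nonneg_right (hgeom _ _ (by norm_num) (by norm_num)) two_pos.le
          _ = 4 := by norm_num
    _ = _ := mul_comm _ _

end Bad

/-! ### Means with respect to laws on finite types -/

section Mean

variable {α β : Type*} [Fintype α] [Fintype β]

/-- The mean of `f` under the law `p`. -/
def mean (p : PMF α) (f : α → ℝ) : ℝ := ∑ a, (p a).toReal * f a

lemma sum_toReal (p : PMF α) : ∑ a, (p a).toReal = 1 := by
  rw [← ENNReal.toReal_sum fun a _ => p.apply_ne_top a, ← tsum_fintype (L := .unconditional _),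
    p.tsum_coe, ENNReal.toReal_one]

lemma mean_const (p : PMF α) (c : ℝ) : mean p (fun _ => c) = c := by
  rw [mean, ← Finset.sum_mul, sum_toReal, one_mul]

lemma mean_mono (p : PMF α) {f g : α → ℝ} (h : ∀ a, f a ≤ g a) : mean p f ≤ mean p g :=
  Finset.sum_le_sum fun a _ => mul_le_mul_of_nonneg_left (h a) ENNReal.toReal_nonneg

lemma mean_mem_Icc (p : PMF α) {f : α → ℝ} (h : ∀ a, f a ∈ Set.Icc (0 : ℝ) 1) :
    mean p f ∈ Set.Icc (0 : ℝ) 1 :=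
  ⟨(mean_const p 0).symm.le.trans (mean_mono p fun a => (h a).1),
    (mean_mono p fun a => (h a).2).trans (mean_const p 1).le⟩

lemma mean_pure (a : α) (f : α → ℝ) : mean (PMF.pure a) f = f a := by
  rw [mean, Finset.sum_eq_single a]
  · simp
  · intro b _ hb; simp [hb]
  · simp

lemma mean_comm (p : PMF α) (q : PMF β) (f : α → β → ℝ) :
    mean p (fun a => mean q (f a)) = mean q fun b => mean p fun a => f a b := by
  simp only [mean, Finset.mul_sum]
  rw [Finset.sum_comm]
  exact Finset.sum_congr rfl fun b _ => Finset.sum_congr rfl fun a _ => by ring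

lemma mean_map (p : PMF α) (g : α → β) (f : β → ℝ) : mean (p.map g) f = mean p (f ∘ g) := by
  have h : ∀ b, (p.map g b).toReal = ∑ a, if b = g a then (p a).toReal else 0 := by
    intro b
    rw [PMF.map_apply, tsum_fintype, ENNReal.toReal_sum]
    · exact Finset.sum_congr rfl fun a _ => by split_ifs <;> simp
    · intro a _; split_ifs
      · exact p.apply_ne_top a
      · simp
  simp only [mean, h, Finset.sum_mul]
  rw [Finset.sum_comm]
  refine Finset.sum_congr rfl fun a _ => ?_
  simp

lemma mean_uniformOfFintype [Nonempty α] (f : α → ℝ) :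
    mean (PMF.uniformOfFintype α) f = ∑ a, (Fintype.card α : ℝ)⁻¹ * f a := by
  simp [mean]

lemma real_toMeasure_bind {γ : Type*} [MeasurableSpace γ] (p : PMF α) (q : α → PMF γ)
    {S : Set γ} (hS : MeasurableSet S) :
    (p.bind q).toMeasure.real S = mean p fun a => (q a).toMeasure.real S := by
  rw [measureReal_def, PMF.toMeasure_bind_apply p q S hS, tsum_fintype, ENNReal.toReal_sum]
  · exact Finset.sum_congr rfl fun a _ => ENNReal.toReal_mul
  · exact fun a _ => ENNReal.mul_ne_top (p.apply_ne_top a) (measure_ne_top _ _)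

lemma real_toMeasure_pure {γ : Type*} [MeasurableSpace γ] (c : γ) {S : Set γ}
    (hS : MeasurableSet S) : (PMF.pure c).toMeasure.real S = if c ∈ S then 1 else 0 := by
  rw [measureReal_def, PMF.toMeasure_pure_apply c S hS]
  split_ifs <;> simp

lemma mean_indepLaw {ι : Type*} [Fintype ι] [DecidableEq ι] {α : ι → Type*} [∀ i, Fintype (α i)]
    (p : ∀ i, PMF (α i)) (f : (∀ i, α i) → ℝ) :
    mean (indepLaw p) f = ∑ x, (∏ i, (p i (x i)).toReal) * f x := by
  refine Finset.sum_congr rfl fun x _ => ?_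
  rw [← ENNReal.toReal_prod]
  rfl

/-- Averaging over the `i`-th coordinate of independent variables first. -/
lemma mean_indepLaw_split {ι : Type*} [Fintype ι] [DecidableEq ι] {α : ι → Type*} [∀ i, Fintype (α i)]
    (p : ∀ i, PMF (α i)) (i : ι) (f : (∀ i, α i) → ℝ) :
    mean (indepLaw p) f = mean (p i) fun a =>
      ∑ y : ∀ j : {j // j ≠ i}, α j, (∏ j : {j // j ≠ i}, (p j (y j)).toReal) *
        f ((Equiv.piSplitAt i α).symm (a, y)) := by
  rw [mean_indepLaw, mean, ← (Equiv.piSplitAt i α).symm.sum_comp, Fintype.sum_prod_type]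
  refine Finset.sum_congr rfl fun a _ => ?_
  rw [Finset.mul_sum]
  refine Finset.sum_congr rfl fun y _ => ?_
  rw [← mul_assoc, Fintype.prod_eq_mul_prod_subtype_ne _ i]
  congr 2
  · simp [Equiv.piSplitAt]
  · refine Finset.prod_congr rfl fun j _ => ?_
    simp [Equiv.piSplitAt, j.2]

end Mean

/-! ### Random graphs -/

section RandomGraph

variable {n : ℕ}

/-- The graph with the given edges. -/
def toGraph (S : Finset (Pairs n)) : SimpleGraph (Fin n) :=
  SimpleGraph.fromEdgeSet (Subtype.val '' (S : Set (Pairs n)))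

lemma edgeSet_toGraph (S : Finset (Pairs n)) :
    (toGraph S).edgeSet = Subtype.val '' (S : Set (Pairs n)) := by
  rw [toGraph, SimpleGraph.edgeSet_fromEdgeSet, sdiff_eq_left, Set.disjoint_left]
  rintro _ ⟨e, -, rfl⟩ h
  exact e.2 h

lemma isSubgraphOf_toGraph {H : KSubgraph n} {S : Finset (Pairs n)} :
    IsSubgraphOf H (toGraph S) ↔ edgePairs H ⊆ S := by
  rw [IsSubgraphOf, edgeSet_toGraph, ← image_edgePairs,
    Set.image_subset_image_iff Subtype.val_injective, Finset.coe_subset]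

lemma toGraph_erase (S : Finset (Pairs n)) (e : Pairs n) :
    toGraph (S.erase e) = (toGraph S).deleteEdges {e.1} := by
  rw [← SimpleGraph.edgeSet_inj, SimpleGraph.edgeSet_deleteEdges, edgeSet_toGraph,
    edgeSet_toGraph, Finset.coe_erase, Set.image_sdiff Subtype.val_injective, Set.image_singleton]

lemma toReal_bernoulliLaw {p : ℝ} (h0 : 0 ≤ p) (h1 : p ≤ 1) (b : Bool) :
    (bernoulliLaw p b).toReal = if b then p else 1 - p := by
  have : bernoulliLaw p b = if b then ENNReal.ofReal (min p 1)
    else 1 - ENNReal.ofReal (min p 1) := rfl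
  rw [this, min_eq_left h1]
  split_ifs
  · exact ENNReal.toReal_ofReal h0
  · rw [ENNReal.toReal_sub_of_le (ENNReal.ofReal_le_one.2 h1) ENNReal.one_ne_top,
      ENNReal.toReal_ofReal h0, ENNReal.toReal_one]

lemma mean_indepEdgeGraph {p : Pairs n → ℝ} (h0 : ∀ e, 0 ≤ p e) (h1 : ∀ e, p e ≤ 1)
    (f : SimpleGraph (Fin n) → ℝ) :
    mean (indepEdgeGraph n p) f = ∑ S, wt p S * f (toGraph S) := by
  rw [indepEdgeGraph, mean_map, mean_indepLaw]
  refine Finset.sum_bij' (fun x _ => Finset.univ.filter fun e => x e = true)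
    (fun S _ e => decide (e ∈ S)) ?_ ?_ ?_ ?_ ?_
  · simp
  · simp
  · intro x _; funext e; simp
  · intro S _; ext e; simp
  · intro x _
    congr 1
    · simp only [toReal_bernoulliLaw (h0 _) (h1 _)]
      rw [Finset.prod_ite, wt]
      congr 2
      ext e; simp
    · simp only [Function.comp_apply, toGraph]
      congr 2
      ext e
      simp

lemma mean_sbm {k : ℕ} [NeZero k] {lam ε : ℝ} {σ : Fin n → Fin k} {p : Pairs n → ℝ}
    (hp : p = fun e => if (e.1.map σ).IsDiag then (1 + ((k : ℝ) - 1) * ε) * lam / n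
      else (1 - ε) * lam / n) (h0 : ∀ e, 0 ≤ p e) (h1 : ∀ e, p e ≤ 1)
    (f : SimpleGraph (Fin n) → ℝ) :
    mean (sbmGivenLabels n k lam ε σ) f = ∑ S, wt p S * f (toGraph S) := by
  rw [← mean_indepEdgeGraph h0 h1, hp, sbmGivenLabels]

end RandomGraph

/-! ### The removal of selected edges -/

section Removal

variable {n k N : ℕ} {lam D : ℝ} {f : SimpleGraph (Fin n) → ℝ}

lemma removalLaw_eq_pure {G : SimpleGraph (Fin n)}
    (h : ∀ H : Target n k N lam D, ¬ IsSubgraphOf H.1 G) :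
    mean (removalLaw n k N lam D G) f = f G := by
  have h1 : ∀ H : Target n k N lam D, selectedEdge G H.1 = PMF.pure none := by
    intro H
    rw [selectedEdge, dif_neg fun h' => h H h'.1]
  rw [removalLaw, mean_map, mean_indepLaw, Finset.sum_eq_single fun _ => none]
  · simp [h1]
  · intro c _ hc
    obtain ⟨H, hH⟩ := Function.ne_iff.1 hc
    rw [Finset.prod_eq_zero (Finset.mem_univ H), zero_mul]
    rw [h1, PMF.pure_apply, if_neg hH, ENNReal.toReal_zero]
  · simp

lemma mean_selectedEdge {G : SimpleGraph (Fin n)} {H : KSubgraph n} (hH : IsSubgraphOf H G)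
    (hne : (edgePairs H).Nonempty) (φ : Option (Sym2 (Fin n)) → ℝ) :
    mean (selectedEdge G H) φ = (∑ e ∈ edgePairs H, φ (some e.1)) / (edgePairs H).card := by
  have himg : H.edgeSet.toFinset = (edgePairs H).image Subtype.val := by
    rw [← Finset.coe_inj, Finset.coe_image, image_edgePairs, Set.coe_toFinset]
  have hne' : H.edgeSet.Nonempty := by
    obtain ⟨e, he⟩ := hne
    exact ⟨e.1, mem_edgePairs.1 he⟩
  have hcard : H.edgeSet.toFinset.card = (edgePairs H).card := by
    rw [himg, Finset.card_image_of_injective _ Subtype.val_injective]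
  rw [selectedEdge, dif_pos ⟨hH, hne'⟩, mean_map, mean]
  simp only [PMF.uniformOfFinset_apply, Function.comp_apply]
  rw [← Finset.sum_subset (Finset.subset_univ H.edgeSet.toFinset), Finset.sum_div]
  · rw [himg, Finset.sum_image Subtype.val_injective.injOn]
    refine Finset.sum_congr rfl fun e he => ?_
    rw [if_pos (Finset.mem_image_of_mem _ he), ← himg, hcard, ENNReal.toReal_inv,
      ENNReal.toReal_natCast, inv_mul_eq_div]
  · intro e _ he
    rw [if_neg he]; simp

/-- If the target `C` is contained in `G` and edge-disjoint from the other targets in `G`, one may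
remove an edge of `C` first and then apply the removal procedure to the remaining graph. -/
lemma mean_removalLaw_step {G : SimpleGraph (Fin n)} (C : Target n k N lam D)
    (hC : IsSubgraphOf C.1 G) (hne : (edgePairs C.1).Nonempty)
    (hdisj : ∀ H : Target n k N lam D, H ≠ C → IsSubgraphOf H.1 G →
      Disjoint H.1.edgeSet C.1.edgeSet) :
    mean (removalLaw n k N lam D G) f =
      (∑ e ∈ edgePairs C.1, mean (removalLaw n k N lam D (G.deleteEdges {e.1})) f) /
        (edgePairs C.1).card := by
  rw [removalLaw, mean_map, mean_indepLaw_split _ C, mean_selectedEdge hC hne]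
  congr 1
  refine Finset.sum_congr rfl fun e he => ?_
  have heC : e.1 ∈ C.1.edgeSet := mem_edgePairs.1 he
  -- After `e` is deleted, `C` is no longer contained in the graph and selects nothing, while the
  -- other targets keep their selection laws by edge-disjointness. The two procedures thus agree
  -- coordinatewise.
  have hsel : selectedEdge (G.deleteEdges {e.1}) C.1 = PMF.pure none := by
    rw [selectedEdge, dif_neg]
    intro h
    have := h.1 heC
    simp at this
  have hsel' : ∀ H : Target n k N lam D, H ≠ C →
      selectedEdge (G.deleteEdges {e.1}) H.1 = selectedEdge G H.1 := by
    intro H hHC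
    have : IsSubgraphOf H.1 (G.deleteEdges {e.1}) ↔ IsSubgraphOf H.1 G := by
      rw [IsSubgraphOf, IsSubgraphOf, SimpleGraph.edgeSet_deleteEdges]
      refine ⟨fun h => h.trans Set.sdiff_subset, fun h e' he' => ⟨h he', ?_⟩⟩
      rintro rfl
      exact Set.disjoint_left.1 (hdisj H hHC h) he' heC
    simp only [selectedEdge, this]
  rw [removalLaw, mean_map, mean_indepLaw_split _ C]
  simp only [hsel, mean_pure]
  refine Finset.sum_congr rfl fun y _ => ?_
  congr 1
  · exact Finset.prod_congr rfl fun H _ => by rw [hsel' H.1 H.2]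
  · simp only [Function.comp_apply]
    congr 1
    rw [SimpleGraph.deleteEdges_deleteEdges]
    congr 1
    ext e'
    simp only [Set.mem_ofPred_eq, Set.mem_union, Set.mem_singleton_iff]
    have hsplit : ∀ (a : Option (Sym2 (Fin n))),
        (∃ H, (Equiv.piSplitAt C fun _ : Target n k N lam D => Option (Sym2 (Fin n))).symm (a, y) H
          = some e') ↔ a = some e' ∨ ∃ H, y H = some e' := by
      intro a
      constructor
      · rintro ⟨H, hH⟩
        by_cases hHC : H = C
        · subst hHC; left; simpa [Equiv.piSplitAt] using hH
        · right; exact ⟨⟨H, hHC⟩, by simpa [Equiv.piSplitAt, hHC] using hH⟩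
      · rintro (h | ⟨H, hH⟩)
        · exact ⟨C, by simpa [Equiv.piSplitAt] using h⟩
        · exact ⟨H.1, by simpa [Equiv.piSplitAt, H.2] using hH⟩
    rw [hsplit, hsplit]
    simp [eq_comm]

end Removal

/-! ### The block model as a target model -/

/-- Functions of disjoint sets of coordinates of a uniform labelling are uncorrelated. -/
lemma sum_uniform_mul {α β : Type*} [Fintype α] [DecidableEq α] [Fintype β]
    [Nonempty β] (s : Set α)
    {F F' : (α → β) → ℝ} (hF : ∀ σ τ : α → β, (∀ a ∈ s, σ a = τ a) → F σ = F τ)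
    (hF' : ∀ σ τ : α → β, (∀ a ∉ s, σ a = τ a) → F' σ = F' τ) :
    ∑ σ, (Fintype.card (α → β) : ℝ)⁻¹ * (F σ * F' σ) =
      (∑ σ, (Fintype.card (α → β) : ℝ)⁻¹ * F σ) *
        ∑ σ, (Fintype.card (α → β) : ℝ)⁻¹ * F' σ := by
  have hc : (Fintype.card (α → β) : ℝ) ≠ 0 := by exact_mod_cast Fintype.card_ne_zero
  -- Two labellings exchange their values outside `s`. This bijection turns `F z.1 * F' z.2` into a
  -- product evaluated at a single labelling.
  let mix : (α → β) × (α → β) → (α → β) × (α → β) :=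
    fun z => (s.piecewise z.1 z.2, s.piecewise z.2 z.1)
  have hmix : Function.Involutive mix := by
    intro z
    ext a <;> by_cases ha : a ∈ s <;> simp [mix, ha]
  have h1 : (∑ σ, F σ) * ∑ σ, F' σ = Fintype.card (α → β) * ∑ σ, F σ * F' σ := by
    calc _ = ∑ z : (α → β) × (α → β), F z.1 * F' z.2 := by
          rw [Finset.sum_mul_sum, Fintype.sum_prod_type]
      _ = ∑ z : (α → β) × (α → β), F z.1 * F' z.1 := by
          refine Fintype.sum_equiv hmix.toPerm _ _ fun z => ?_
          congr 1
          · exact hF _ _ fun a ha => by simp [mix, ha]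
          · exact hF' _ _ fun a ha => by simp [mix, ha]
      _ = _ := by
          rw [Fintype.sum_prod_type]
          simp only [Finset.sum_const, nsmul_eq_mul, Finset.card_univ, ← Finset.mul_sum]
  rw [← Finset.mul_sum, ← Finset.mul_sum, ← Finset.mul_sum, mul_mul_mul_comm, h1]
  field_simp

/-- The conditional probability that the pair `e` is an edge, given the labels. -/
def edgeProb (n k : ℕ) (lam ε : ℝ) (σ : Fin n → Fin k) (e : Pairs n) : ℝ :=
  if (e.1.map σ).IsDiag then (1 + ((k : ℝ) - 1) * ε) * lam / n else (1 - ε) * lam / n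

lemma prod_edgeProb_congr {n k : ℕ} {lam ε : ℝ} {H : KSubgraph n} {σ τ : Fin n → Fin k}
    (h : ∀ v ∈ H.verts, σ v = τ v) :
    ∏ e ∈ edgePairs H, edgeProb n k lam ε σ e = ∏ e ∈ edgePairs H, edgeProb n k lam ε τ e := by
  refine Finset.prod_congr rfl fun e he => ?_
  have : e.1.map σ = e.1.map τ := Sym2.map_congr fun v hv =>
    h v (SimpleGraph.Subgraph.mem_verts_of_mem_edge (mem_edgePairs.1 he) hv)
  rw [edgeProb, edgeProb, this]

variable {n k N : ℕ} [NeZero k] {lam ε s D : ℝ}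

lemma one_le_natCast_of_neZero (k : ℕ) [NeZero k] : (1 : ℝ) ≤ k := by
  exact_mod_cast NeZero.one_le

lemma edgeProb_mem (hlam : 0 < lam) (hε : ε ∈ Set.Ioo (0 : ℝ) 1) (σ : Fin n → Fin k)
    (e : Pairs n) : edgeProb n k lam ε σ e ∈ Set.Icc 0 (k * max lam 1 / n) := by
  have hk := one_le_natCast_of_neZero k
  obtain ⟨h0, h1⟩ := hε
  have hl : lam ≤ max lam 1 := le_max_left _ _
  have hkl : (k : ℝ) * lam ≤ k * max lam 1 := by gcongr
  have ha : 0 ≤ ((k : ℝ) - 1) * ε := mul_nonneg (by linarith) h0.le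
  have hb : ((k : ℝ) - 1) * ε ≤ k - 1 := mul_le_of_le_one_right (by linarith) h1.le
  rw [edgeProb]
  split_ifs
  · refine ⟨by positivity, ?_⟩
    gcongr
    linarith
  · refine ⟨div_nonneg (mul_nonneg (by linarith) hlam.le) (Nat.cast_nonneg _), ?_⟩
    gcongr
    linarith

lemma disjoint_edgePairs {H H' : KSubgraph n} (h : ¬ (H.verts ∩ H'.verts).Nonempty) :
    Disjoint (edgePairs H) (edgePairs H') := by
  rw [Finset.disjoint_left]
  intro e h1 h2
  rw [mem_edgePairs] at h1 h2
  exact h ⟨e.1.out.1, SimpleGraph.Subgraph.mem_verts_of_mem_edge h1 e.1.out_fst_mem,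
    SimpleGraph.Subgraph.mem_verts_of_mem_edge h2 e.1.out_fst_mem⟩

lemma sum_uniform_prod_edgeProb {H H' : KSubgraph n} (h : ¬ (H.verts ∩ H'.verts).Nonempty) :
    ∑ σ : Fin n → Fin k, (Fintype.card (Fin n → Fin k) : ℝ)⁻¹ *
        ((∏ e ∈ edgePairs H, edgeProb n k lam ε σ e) *
          ∏ e ∈ edgePairs H', edgeProb n k lam ε σ e) =
      (∑ σ : Fin n → Fin k, (Fintype.card (Fin n → Fin k) : ℝ)⁻¹ *
        ∏ e ∈ edgePairs H, edgeProb n k lam ε σ e) *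
      ∑ σ : Fin n → Fin k, (Fintype.card (Fin n → Fin k) : ℝ)⁻¹ *
        ∏ e ∈ edgePairs H', edgeProb n k lam ε σ e :=
  sum_uniform_mul H.verts (fun _ _ hστ => prod_edgeProb_congr hστ) fun _ _ hστ =>
    prod_edgeProb_congr fun v hv => hστ v fun hv' => h ⟨v, hv', hv⟩

/-- The block model with the short cycles as targets. -/
def sbmModel (n k N : ℕ) [NeZero k] (lam ε D : ℝ) (hlam : 0 < lam) (hε : ε ∈ Set.Ioo (0 : ℝ) 1)
    (hn : 2 * (k * max lam 1) ≤ n) :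
    TargetModel (Pairs n) (ShortCycle n N) (Fin n → Fin k) where
  u _ := (Fintype.card (Fin n → Fin k) : ℝ)⁻¹
  p := edgeProb n k lam ε
  x := k * max lam 1 / n
  E C := edgePairs C.1
  -- All small bad graphs are excluded here, in particular the self-bad ones, so the targets of the
  -- model can be the cycles alone.
  Bad S := ∃ H : KSubgraph n, edgePairs H ⊆ S ∧ IsBad n k lam D H ∧ IsSmall n D H
  near C C' := (C.1.verts ∩ C'.1.verts).Nonempty
  u_nonneg _ := by positivity
  sum_u := by simp
  p_nonneg σ e := (edgeProb_mem hlam hε σ e).1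
  p_le σ e := (edgeProb_mem hlam hε σ e).2
  x_nonneg := by positivity
  x_le := by
    have hk := one_le_natCast_of_neZero k
    have ha : (1 : ℝ) ≤ max lam 1 := le_max_right _ _
    have : (0 : ℝ) < n := by nlinarith
    rw [div_le_iff₀ this]
    linarith
  nonempty C := C.2.edgePairs_nonempty
  mono S S' h := fun ⟨H, hH⟩ => ⟨H, hH.1.trans h, hH.2⟩
  disjoint C C' h := disjoint_edgePairs h
  indep C C' h := sum_uniform_prod_edgeProb h

section Model

variable (N D) (hlam : 0 < lam) (hε : ε ∈ Set.Ioo (0 : ℝ) 1) (hn : 2 * (k * max lam 1) ≤ n)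

lemma mean_uniform_sbm (h : (Fin n → Fin k) → SimpleGraph (Fin n) → ℝ) :
    mean (PMF.uniformOfFintype (Fin n → Fin k))
      (fun σ => mean (sbmGivenLabels n k lam ε σ) (h σ)) =
      (sbmModel n k N lam ε D hlam hε hn).avg fun σ S => h σ (toGraph S) := by
  rw [mean_uniformOfFintype]
  refine Finset.sum_congr rfl fun σ _ => ?_
  rw [mean_sbm rfl (sbmModel n k N lam ε D hlam hε hn |>.p_nonneg σ)
    (sbmModel n k N lam ε D hlam hε hn |>.p_le_one σ)]
  rfl

variable {N D}

lemma badProb_sbmModel_le (hD : 1 ≤ D) (hDn : D ^ 50 ≤ n) (hlog : 1 ≤ Real.log n) :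
    (sbmModel n k N lam ε D hlam hε hn).badProb ≤ 4 * (Real.log n)⁻¹ := by
  refine le_trans ?_ (sum_bad_le (k := k) (lam := lam) NeZero.one_le hD hDn hlog)
  set 𝓜 := sbmModel n k N lam ε D hlam hε hn
  have h : ∀ S, (if 𝓜.Bad S then (1 : ℝ) else 0) ≤ ∑ H : KSubgraph n,
      (if IsBad n k lam D H ∧ IsSmall n D H then 1 else 0) *
        (if edgePairs H ⊆ S then (1 : ℝ) else 0) := by
    intro S
    have hpos : ∀ H : KSubgraph n, (0 : ℝ) ≤
        (if IsBad n k lam D H ∧ IsSmall n D H then 1 else 0) *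
        (if edgePairs H ⊆ S then (1 : ℝ) else 0) := by
      intro H; split_ifs <;> norm_num
    split_ifs with hb
    · obtain ⟨H, h1, h2⟩ := hb
      refine le_trans ?_ (Finset.single_le_sum (fun H _ => hpos H) (Finset.mem_univ H))
      simp [h1, h2]
    · exact Finset.sum_nonneg fun H _ => hpos H
  refine (𝓜.avg_mono fun _ S => h S).trans ?_
  rw [𝓜.avg_sum]
  refine Finset.sum_le_sum fun H _ => ?_
  rw [𝓜.avg_const_mul]
  split_ifs
  · rw [one_mul]
    exact 𝓜.avg_indicator_subset_le _
  · rw [zero_mul]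

lemma kappa_sbmModel_le :
    (sbmModel n k N lam ε D hlam hε hn).kappa ≤
      graphCount N * ((N + 1) * (k * max lam 1) ^ N) := by
  have hk := one_le_natCast_of_neZero k
  have ha : (1 : ℝ) ≤ max lam 1 := le_max_right _ _
  have h1 : 1 ≤ k * max lam 1 := one_le_mul_of_one_le_of_one_le hk ha
  have : (0 : ℝ) < n := by linarith
  exact sum_shortCycle_le h1 (by exact_mod_cast this)

lemma rho_sbmModel_le :
    (sbmModel n k N lam ε D hlam hε hn).rho ≤ k * max lam 1 / n *
      ((graphCount (2 * N) ^ 2 : ℕ) * ((2 * N + 1) * (k * max lam 1) ^ (2 * N))) := by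
  have hk := one_le_natCast_of_neZero k
  have ha : (1 : ℝ) ≤ max lam 1 := le_max_right _ _
  have h1 : 1 ≤ k * max lam 1 := one_le_mul_of_one_le_of_one_le hk ha
  have h2 : k * max lam 1 ≤ n := by linarith
  refine le_trans (le_of_eq ?_) (sum_near_shortCycle_le h1 h2)
  refine Finset.sum_congr rfl fun C _ => Finset.sum_congr rfl fun C' _ => ?_
  congr

variable {f : SimpleGraph (Fin n) → ℝ}

lemma spaced_sbmModel_iff {S : Finset (Pairs n)} :
    (Spaced (sbmModel n k N lam ε D hlam hε hn).Bad (sbmModel n k N lam ε D hlam hε hn).E S ∧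
      numIn (sbmModel n k N lam ε D hlam hε hn).E S = 0) ↔ IsGood n k N lam D (toGraph S) := by
  have h0 : numIn (sbmModel n k N lam ε D hlam hε hn).E S = 0 ↔
      ∀ C : ShortCycle n N, ¬ edgePairs C.1 ⊆ S := by
    simp only [numIn, Finset.card_eq_zero, Finset.filter_eq_empty_iff, Finset.mem_univ,
      true_implies]
    rfl
  rw [h0]
  constructor
  · rintro ⟨h1, h2⟩ H hH
    rw [isSubgraphOf_toGraph] at hH
    exact ⟨fun h => h1.1 ⟨H, hH, h⟩, fun h => h2 ⟨H, h⟩ hH⟩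
  · intro h
    have h2 : ∀ C : ShortCycle n N, ¬ edgePairs C.1 ⊆ S := fun C hC =>
      (h C.1 (isSubgraphOf_toGraph.2 hC)).2 C.2
    exact ⟨⟨fun ⟨H, h1, h3⟩ => (h H (isSubgraphOf_toGraph.2 h1)).1 h3,
      fun C _ _ hC => absurd hC (h2 C)⟩, h2⟩

lemma mean_removalLaw_of_isGood {G : SimpleGraph (Fin n)} (hG : IsGood n k N lam D G) :
    mean (removalLaw n k N lam D G) f = f G := by
  refine removalLaw_eq_pure fun H hH => ?_
  rcases H.2 with h | h
  · exact (hG H.1 hH).1 ⟨h.1.1, h.2⟩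
  · exact (hG H.1 hH).2 h

/-- The averaging hypothesis of the abstract theorem. A self-bad target in `S` would contradict
spacedness, and the remaining targets in `S` are cycles edge-disjoint from `C`. -/
lemma mean_removalLaw_toGraph_step (S : Finset (Pairs n)) (C : ShortCycle n N)
    (hS : Spaced (sbmModel n k N lam ε D hlam hε hn).Bad
      (sbmModel n k N lam ε D hlam hε hn).E S)
    (hC : (sbmModel n k N lam ε D hlam hε hn).E C ⊆ S) :
    mean (removalLaw n k N lam D (toGraph S)) f =
      (∑ e ∈ (sbmModel n k N lam ε D hlam hε hn).E C,
        mean (removalLaw n k N lam D (toGraph (S.erase e))) f) /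
        ((sbmModel n k N lam ε D hlam hε hn).E C).card := by
  simp only [toGraph_erase]
  refine mean_removalLaw_step (⟨C.1, Or.inr C.2⟩ : Target n k N lam D)
    (isSubgraphOf_toGraph.2 hC) C.2.edgePairs_nonempty fun H hne hH => ?_
  rw [isSubgraphOf_toGraph] at hH
  rcases H.2 with h | h
  · exact absurd ⟨H.1, hH, h.1.1, h.2⟩ hS.1
  · have hd := hS.2 ⟨H.1, h⟩ C
      (fun h' => hne (Subtype.ext (congrArg (fun C : ShortCycle n N => C.1) h'))) hH hC
    rw [← image_edgePairs, ← image_edgePairs, Set.disjoint_image_iff Subtype.val_injective]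
    exact Finset.disjoint_coe.2 hd

lemma level_zero_sbmModel :
    (sbmModel n k N lam ε D hlam hε hn).level
      (fun S => mean (removalLaw n k N lam D (toGraph S)) f) 0 =
      (sbmModel n k N lam ε D hlam hε hn).avg fun _ S =>
        if IsGood n k N lam D (toGraph S) then f (toGraph S) else 0 := by
  rw [TargetModel.level]
  congr 1
  funext _ S
  simp only [spaced_sbmModel_iff]
  split_ifs with h
  · exact mean_removalLaw_of_isGood h
  · rfl

end Model

/-! ### The laws of the observed pairs -/

/-- The probability, given the (possibly modified) parent graph `g`, that the observed pair of
graphs lies in `U`. -/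
def obsProb (n : ℕ) (s : ℝ) (U : Set (SimpleGraph (Fin n) × SimpleGraph (Fin n)))
    (g : SimpleGraph (Fin n)) : ℝ :=
  mean (PMF.uniformOfFintype (Equiv.Perm (Fin n))) fun π =>
    mean (indepEdgeGraph n fun _ => s) fun J =>
      mean (indepEdgeGraph n fun _ => s) fun K =>
        if (g ⊓ J, relabel π g ⊓ K) ∈ U then 1 else 0

lemma obsProb_mem (U : Set (SimpleGraph (Fin n) × SimpleGraph (Fin n)))
    (g : SimpleGraph (Fin n)) : obsProb n s U g ∈ Set.Icc (0 : ℝ) 1 :=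
  mean_mem_Icc _ fun _ => mean_mem_Icc _ fun _ => mean_mem_Icc _ fun _ => by
    split_ifs <;> simp

lemma obsProb_univ (g : SimpleGraph (Fin n)) : obsProb n s Set.univ g = 1 := by
  simp [obsProb, mean_const]

/-- The permutation is independent of the labels and of the graph, so its average moves inside. The
event then enters only through the test function `obsProb` of the modified graph. -/
lemma real_modifiedPairLaw {U : Set (SimpleGraph (Fin n) × SimpleGraph (Fin n))}
    (hU : MeasurableSet U) :
    (modifiedPairLaw n k N lam ε s D).real U =
      mean (PMF.uniformOfFintype (Fin n → Fin k)) fun σ => mean (sbmGivenLabels n k lam ε σ)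
        fun G => mean (removalLaw n k N lam D G) (obsProb n s U) := by
  rw [modifiedPairLaw, map_measureReal_apply measurable_from_top hU, modifiedJointLaw]
  simp only [real_toMeasure_bind _ _ MeasurableSpace.measurableSet_top,
    real_toMeasure_pure _ MeasurableSpace.measurableSet_top]
  congr 1
  funext σ
  rw [mean_comm]
  congr 1
  funext G
  rw [mean_comm]
  rfl

lemma real_jointLaw_good (U : Set (SimpleGraph (Fin n) × SimpleGraph (Fin n))) :
    (jointLaw n k lam ε s).toMeasure.real
      ({x | IsGood n k N lam D x.G} ∩ (fun x => (x.A, x.B)) ⁻¹' U) =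
      mean (PMF.uniformOfFintype (Fin n → Fin k)) fun σ => mean (sbmGivenLabels n k lam ε σ)
        fun G => if IsGood n k N lam D G then obsProb n s U G else 0 := by
  rw [jointLaw]
  simp only [real_toMeasure_bind _ _ MeasurableSpace.measurableSet_top,
    real_toMeasure_pure _ MeasurableSpace.measurableSet_top]
  congr 1
  funext σ
  rw [mean_comm]
  congr 1
  funext G
  by_cases hG : IsGood n k N lam D G
  · simp only [Set.mem_inter_iff, Set.mem_ofPred_eq, hG, true_and, if_true]
    rfl
  · simp only [Set.mem_inter_iff, Set.mem_ofPred_eq, hG, false_and, if_false, mean_const]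

lemma real_condPairLaw {U : Set (SimpleGraph (Fin n) × SimpleGraph (Fin n))}
    (hU : MeasurableSet U) :
    (condPairLaw n k N lam ε s D).real U =
      (mean (PMF.uniformOfFintype (Fin n → Fin k)) fun σ => mean (sbmGivenLabels n k lam ε σ)
        fun G => if IsGood n k N lam D G then obsProb n s U G else 0) /
      mean (PMF.uniformOfFintype (Fin n → Fin k)) fun σ => mean (sbmGivenLabels n k lam ε σ)
        fun G => if IsGood n k N lam D G then 1 else 0 := by
  have h1 := real_jointLaw_good (N := N) (lam := lam) (ε := ε) (s := s) (D := D) (k := k)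
    (Set.univ : Set (SimpleGraph (Fin n) × SimpleGraph (Fin n)))
  simp only [obsProb_univ, Set.preimage_univ, Set.inter_univ] at h1
  rw [condPairLaw, map_measureReal_apply measurable_from_top hU,
    measureReal_def, cond_apply MeasurableSpace.measurableSet_top, ENNReal.toReal_mul,
    ENNReal.toReal_inv, ← measureReal_def, ← measureReal_def, real_jointLaw_good, h1,
    inv_mul_eq_div]

lemma tvDist_nonneg {Ω : Type*} [MeasurableSpace Ω] (μ ν : Measure Ω) : 0 ≤ tvDist μ ν :=
  Real.iSup_nonneg fun _ => abs_nonneg _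

/-- If a nonnegative weight is, up to the factor `c`, almost a probability, then that probability is
close to the normalized weight. -/
lemma abs_sub_div_le {P Q q c η : ℝ} (hP : |P - c * Q| ≤ η) (hq : |1 - c * q| ≤ η) (hη : η < 1)
    (hQ : 0 ≤ Q) (hQq : Q ≤ q) : |P - Q / q| ≤ 2 * η := by
  -- Positivity of the conditioning probability is not assumed: `q = 0` would force `1 ≤ η`.
  have hq0 : 0 < q := by
    rcases (hQ.trans hQq).eq_or_lt with h | h
    · rw [← h, mul_zero, sub_zero, abs_one] at hq; linarith
    · exact h
  have h1 : |c * Q - Q / q| ≤ η := by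
    have : c * Q - Q / q = -(1 - c * q) * (Q / q) := by field_simp; ring
    rw [this, abs_mul, abs_neg, abs_of_nonneg (div_nonneg hQ hq0.le)]
    have h2 : Q / q ≤ 1 := (div_le_one hq0).2 hQq
    calc _ ≤ η * 1 := mul_le_mul hq h2 (div_nonneg hQ hq0.le) ((abs_nonneg _).trans hq)
      _ = η := mul_one _
  have := abs_sub_le P (c * Q) (Q / q)
  linarith

/-- The distance of the two laws is at most twice the total error. -/
lemma tvDist_le (hlam : 0 < lam) (hε : ε ∈ Set.Ioo (0 : ℝ) 1) (hn : 2 * (k * max lam 1) ≤ n)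
    {M : ℕ} {η : ℝ} (hM : (sbmModel n k N lam ε D hlam hε hn).totalError M ≤ η) (hη : η < 1) :
    tvDist (modifiedPairLaw n k N lam ε s D) (condPairLaw n k N lam ε s D) ≤ 2 * η := by
  have : Nonempty {S : Set (SimpleGraph (Fin n) × SimpleGraph (Fin n)) // MeasurableSet S} :=
    ⟨⟨∅, MeasurableSet.empty⟩⟩
  refine ciSup_le fun U => ?_
  set 𝓜 := sbmModel n k N lam ε D hlam hε hn
  have key : ∀ f : SimpleGraph (Fin n) → ℝ, (∀ g, f g ∈ Set.Icc (0 : ℝ) 1) →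
      |𝓜.avg (fun _ S => mean (removalLaw n k N lam D (toGraph S)) f) -
        (∑ m ∈ Finset.range (M + 1), 𝓜.mu ^ m / m.factorial) *
          𝓜.avg (fun _ S => if IsGood n k N lam D (toGraph S) then f (toGraph S) else 0)| ≤ η := by
    intro f hf
    rw [← level_zero_sbmModel]
    refine (𝓜.abs_avg_sub_mul_level_zero_le (fun S => ?_)
      (fun S C => mean_removalLaw_toGraph_step hlam hε hn S C) M).trans hM
    have := mean_mem_Icc (removalLaw n k N lam D (toGraph S)) hf
    rw [abs_of_nonneg this.1]
    exact this.2
  rw [real_modifiedPairLaw U.2, real_condPairLaw U.2,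
    mean_uniform_sbm N D hlam hε hn (fun _ G => mean (removalLaw n k N lam D G) _),
    mean_uniform_sbm N D hlam hε hn (fun _ G => if IsGood n k N lam D G then _ else 0),
    mean_uniform_sbm N D hlam hε hn (fun _ G => if IsGood n k N lam D G then 1 else 0)]
  -- The constant test function identifies the universal factor, up to `η`, as the inverse of the
  -- probability of the good event.
  have h1 := key (fun _ => 1) fun _ => by simp
  simp only [mean_const] at h1
  rw [𝓜.avg_const] at h1
  refine abs_sub_div_le (key _ (obsProb_mem U.1)) h1 hη ?_ ?_
  · exact 𝓜.avg_nonneg fun _ S => by split_ifs <;> simp [(obsProb_mem U.1 _).1]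
  · exact 𝓜.avg_mono fun _ S => by split_ifs <;> simp [(obsProb_mem U.1 _).2]

/-! ### Asymptotics -/

/-- A bound for the total error in terms of bounds for its ingredients. -/
def errorBound (κ : ℝ) (M : ℕ) (a b : ℝ) : ℝ :=
  a + b + κ / (M + 1) +
    (M + 1) * ((√((κ + b + κ ^ 2) * (a + b)) + √(4 * b + 4 * b)) * (1 + κ) ^ M)

lemma TargetModel.totalError_le {ι T Λ : Type*} [Fintype ι] [DecidableEq ι] [Fintype T] [Fintype Λ]
    (𝓜 : TargetModel ι T Λ) {κ a b : ℝ} (hκ : 𝓜.kappa ≤ κ) (ha : 𝓜.badProb ≤ a)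
    (hb : 𝓜.rho ≤ b) (hx : 𝓜.x * 𝓜.kappa ≤ b) (M : ℕ) :
    𝓜.totalError M ≤ errorBound κ M a b := by
  have h1 := 𝓜.kappa_nonneg
  have h2 := 𝓜.rho_nonneg
  have h3 := 𝓜.badProb_nonneg
  rw [TargetModel.totalError, TargetModel.fluct, errorBound]
  gcongr
  nlinarith

/-- For fixed `M` the bound is continuous in `a` and `b`, and only the Markov tail survives at zero.
-/
lemma tendsto_errorBound {a b : ℕ → ℝ} (ha : Tendsto a atTop (𝓝 0)) (hb : Tendsto b atTop (𝓝 0))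
    (κ : ℝ) (M : ℕ) :
    Tendsto (fun n => errorBound κ M (a n) (b n)) atTop (𝓝 (κ / (M + 1))) := by
  have h : Continuous fun z : ℝ × ℝ => errorBound κ M z.1 z.2 := by
    unfold errorBound
    fun_prop
  have h0 : errorBound κ M 0 0 = κ / (M + 1) := by simp [errorBound]
  rw [← h0]
  exact (h.tendsto (0, 0)).comp (ha.prodMk_nhds hb)

lemma eventually_pow_fifty_le {D : ℕ → ℝ} (hD : ∀ᶠ n : ℕ in atTop, 1 ≤ D n)
    (hD' : Tendsto (fun n : ℕ => Real.log (D n) / Real.log n) atTop (𝓝 0)) :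
    ∀ᶠ n : ℕ in atTop, D n ^ 50 ≤ n := by
  filter_upwards [hD, hD'.eventually (gt_mem_nhds (show (0 : ℝ) < 1 / 50 by norm_num)),
    eventually_gt_atTop 1] with n h1 h2 h3
  have hn : (1 : ℝ) < n := by exact_mod_cast h3
  rw [div_lt_iff₀ (Real.log_pos hn)] at h2
  rw [← Real.log_le_log_iff (by positivity) (by linarith), Real.log_pow]
  push_cast
  linarith

end

end CorrelatedSBM

open CorrelatedSBM in
theorem mainTheorem4 (k : ℕ) [NeZero k] (N : ℕ) (lam ε s : ℝ) (hlam : 0 < lam)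
    (hε : ε ∈ Set.Ioo (0 : ℝ) 1) (hs : s ∈ Set.Ioo (0 : ℝ) 1) (D : ℕ → ℝ)
    (hD : ∀ᶠ n : ℕ in atTop, 2 * Real.logb 2 n ≤ D n)
    (hD' : Tendsto (fun n : ℕ => Real.log (D n) / Real.log n) atTop (𝓝 0)) :
    Tendsto
      (fun n : ℕ => CorrelatedSBM.tvDist
        (CorrelatedSBM.modifiedPairLaw n k N lam ε s (D n))
        (CorrelatedSBM.condPairLaw n k N lam ε s (D n)))
      atTop (𝓝 0) := by
  have hlog : Tendsto (fun n : ℕ => Real.log n) atTop atTop :=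
    Real.tendsto_log_atTop.comp tendsto_natCast_atTop_atTop
  have hD1 : ∀ᶠ n : ℕ in atTop, 1 ≤ D n := by
    filter_upwards [hD, eventually_ge_atTop 2] with n h1 h2
    have h3 : 1 ≤ Real.logb 2 n := by
      rw [Real.le_logb_iff_rpow_le one_lt_two (by positivity)]
      simpa using (by exact_mod_cast h2 : (2 : ℝ) ≤ n)
    linarith
  set κ : ℝ := graphCount N * ((N + 1) * (k * max lam 1) ^ N) with hκ
  set κ₂ : ℝ := (graphCount (2 * N) ^ 2 : ℕ) * ((2 * N + 1) * (k * max lam 1) ^ (2 * N)) with hκ₂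
  have hκ0 : 0 ≤ κ := by positivity
  have hκ₂0 : 0 ≤ κ₂ := by positivity
  have ha : Tendsto (fun n : ℕ => 4 * (Real.log n)⁻¹) atTop (𝓝 0) := by
    simpa using hlog.inv_tendsto_atTop.const_mul 4
  -- One majorant serves both small terms: `κ₂` covers `rho` and `κ` covers `x * kappa`.
  have hb : Tendsto (fun n : ℕ => k * max lam 1 / n * (κ + κ₂)) atTop (𝓝 0) := by
    simpa using (tendsto_const_div_atTop_nhds_zero_nat (k * max lam 1)).mul_const (κ + κ₂)
  rw [Metric.tendsto_atTop']
  intro δ hδ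
  obtain ⟨η, hη0, hη1, hηδ⟩ : ∃ η : ℝ, 0 < η ∧ η < 1 ∧ 2 * η < δ :=
    ⟨min (1 / 2) (δ / 4), by positivity, (min_le_left _ _).trans_lt (by norm_num),
      by linarith [min_le_right (1 / 2) (δ / 4)]⟩
  -- The truncation level is fixed before `n` grows, which is possible because `κ` does not depend
  -- on `n`.
  obtain ⟨M, hM⟩ := exists_nat_gt (κ / η)
  have hMη : κ / (M + 1) < η := by
    rw [div_lt_iff₀ hη0] at hM
    rw [div_lt_iff₀ (by positivity)]
    nlinarith
  have hev := (tendsto_errorBound ha hb κ M).eventually (gt_mem_nhds hMη)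
  have hlarge : ∀ᶠ n : ℕ in atTop, 2 * (k * max lam 1) ≤ (n : ℝ) :=
    tendsto_natCast_atTop_atTop.eventually_ge_atTop _
  have hmain : ∀ᶠ n : ℕ in atTop, dist (tvDist (modifiedPairLaw n k N lam ε s (D n))
      (condPairLaw n k N lam ε s (D n))) 0 < δ := by
    filter_upwards [hev, hlarge, hD1, eventually_pow_fifty_le hD1 hD',
      hlog.eventually_ge_atTop 1] with n h1 h2 h3 h4 h5
    have hκn := kappa_sbmModel_le (N := N) (D := D n) hlam hε h2
    have hx : 0 ≤ k * max lam 1 / (n : ℝ) := by positivity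
    have herr := (sbmModel n k N lam ε (D n) hlam hε h2).totalError_le hκn
      (badProb_sbmModel_le hlam hε h2 h3 h4 h5)
      (b := k * max lam 1 / n * (κ + κ₂))
      ((rho_sbmModel_le hlam hε h2).trans
        (mul_le_mul_of_nonneg_left (by linarith) hx))
      (mul_le_mul_of_nonneg_left (by linarith) hx) M
    rw [Real.dist_0_eq_abs, abs_of_nonneg (tvDist_nonneg _ _)]
    exact (tvDist_le hlam hε h2 (herr.trans h1.le) hη1).trans_lt hηδ
  obtain ⟨n₀, hn₀⟩ := eventually_atTop.1 hmain
  exact ⟨n₀, fun n hn => hn₀ n hn.le⟩
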